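/- Let $C_d=[0,1]^d\subset\mathbb{R}^d$. A triangulation $K$ of an $m$-dimensional lattice polytope $P\subset\mathbb{R}^m$ is called an rdf-triangulation if it is regular (its faces are the projections of the faces of the lower convex hull of the vertices of $K$ lifted by some real-valued function to $\mathbb{R}^{m+1}$), dense (its vertex set is $P\cap\mathbb{Z}^m$) and foldable (its vertices can be colored with $m+1$ colors such that the vertices of each simplex have distinct colors). The dual graph of $K$, whose nodes are the $m$-dimensional simplices (facets) of $K$, two of them being adjacent if they differ in exactly one vertex, is then connected and bipartite, with color classes "black" and "white". The signature of $K$ is the absolute value of the difference between the number of black facets and the number of white facets, where only facets $F$ whose normalized volume $m!\,\mathrm{vol}(F)$ is odd are counted. The signature $\sigma(P)$ is the maximum of the signatures of all rdf-triangulations of $P$. **Theorem.** For every $d\ge 3$ the signature $\sigma(C_d)$ exists (that is, $C_d$ has rdf-triangulations and the maximum is attained), and \[ \sigma(C_d)\;\ge\; \begin{cases} 2^{\frac{d+1}{2}}\left(\frac{d-1}{2}\right)! & \text{if } d\equiv 1 \bmod 2,\\ \left(\frac d2\right)! & \text{if } d\equiv 0 \bmod 4,\\ \frac23\left(\frac d2\right)!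 & \text{if } d\equiv 2 \bmod 4. \end{cases} \] -/

import Mathlib

namespace CubeSignature

/-- A (finite) triangulation of the set `P ⊆ ℝ^m`: a finite geometric simplicial complex whose
underlying space is `P`. -/
def IsTriangulation {m : ℕ} (K : Geometry.SimplicialComplex ℝ (Fin m → ℝ))
    (P : Set (Fin m → ℝ)) : Prop :=
  K.faces.Finite ∧ K.space = P

/-- `F` is (the projection of) a face of the lower convex hull of the lifted points
`(v, lift v)`, `v ∈ V`: some non-vertical hyperplane, the graph of an affine function `a`, passes
through the lifted points of `F` and strictly below all the other lifted points. -/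
def IsLowerFace {m : ℕ} (V : Set (Fin m → ℝ)) (lift : (Fin m → ℝ) → ℝ)
    (F : Finset (Fin m → ℝ)) : Prop :=
  F.Nonempty ∧ (F : Set (Fin m → ℝ)) ⊆ V ∧
    ∃ a : (Fin m → ℝ) →ᵃ[ℝ] ℝ,
      (∀ v ∈ F, a v = lift v) ∧ ∀ v ∈ V, v ∉ F → a v < lift v

/-- A triangulation is regular if, for some lifting function on its vertices, its faces are exactly
the (projected) faces of the lower convex hull of the lifted vertices. Only the values of `lift` on
the vertices matter. -/
def IsRegular {m : ℕ} (K : Geometry.SimplicialComplex ℝ (Fin m → ℝ)) : Prop :=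
  ∃ lift : (Fin m → ℝ) → ℝ, ∀ F, F ∈ K.faces ↔ IsLowerFace K.vertices lift F

/-- The lattice `ℤ^m` in `ℝ^m`. -/
def latticePoints (m : ℕ) : Set (Fin m → ℝ) :=
  {x | ∀ i, ∃ z : ℤ, x i = z}

/-- A triangulation of `P` is dense if its vertices are exactly the lattice points in `P`. -/
def IsDense {m : ℕ} (K : Geometry.SimplicialComplex ℝ (Fin m → ℝ))
    (P : Set (Fin m → ℝ)) : Prop :=
  K.vertices = P ∩ latticePoints m

/-- A triangulation of an `m`-polytope is foldable if it has a non-degenerate simplicial map to an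
`m`-simplex, i.e. a map from its vertices to the `m + 1` vertices of the simplex that is injective
on each face. -/
def IsFoldable {m : ℕ} (K : Geometry.SimplicialComplex ℝ (Fin m → ℝ)) : Prop :=
  ∃ c : K.vertices → Fin (m + 1),
    ∀ F ∈ K.faces, ∀ v w : K.vertices, v.1 ∈ F → w.1 ∈ F → c v = c w → v = w

/-- `K` is an rdf-triangulation of `P`: a regular, dense and foldable triangulation. -/
structure IsRDFTriangulation {m : ℕ} (K : Geometry.SimplicialComplex ℝ (Fin m → ℝ))
    (P : Set (Fin m → ℝ)) : Prop where
  triangulation : IsTriangulation K P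
  regular : IsRegular K
  dense : IsDense K P
  foldable : IsFoldable K

/-- The dual graph: its nodes are the facets, and two facets are adjacent if they differ in one
vertex. -/
def dualGraph {m : ℕ} (K : Geometry.SimplicialComplex ℝ (Fin m → ℝ)) : SimpleGraph K.facets where
  Adj F G := ((F.1 : Set (Fin m → ℝ)) \ G.1).ncard = 1 ∧ ((G.1 : Set (Fin m → ℝ)) \ F.1).ncard = 1
  symm := ⟨fun _ _ h => ⟨h.2, h.1⟩⟩
  loopless := ⟨fun _ h => by simp at h⟩

/-- The normalized volume `m! vol` of a subset of `ℝ^m`. -/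
noncomputable def normalizedVolume {m : ℕ} (P : Set (Fin m → ℝ)) : ℝ :=
  (m.factorial : ℝ) * MeasureTheory.volume.real P

/-- The simplex with vertex set `F` is odd: its normalized volume is an odd integer. -/
def IsOddSimplex {m : ℕ} (F : Finset (Fin m → ℝ)) : Prop :=
  ∃ k : ℤ, Odd k ∧ normalizedVolume (convexHull ℝ (F : Set (Fin m → ℝ))) = k

/-- `s` is the signature of `K`: for a colouring of the dual graph with the colours black (`true`)
and white (`false`), `s` is the absolute value of the number of odd black facets minus the number
of odd white facets. The dual graph of a triangulated polytope is connected, so the colouring is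
unique up to exchanging the two colours and `s` is unique. -/
def HasSignature {m : ℕ} (K : Geometry.SimplicialComplex ℝ (Fin m → ℝ)) (s : ℕ) : Prop :=
  ∃ c : (dualGraph K).Coloring Bool,
    s = Int.natAbs
      (({F : K.facets | IsOddSimplex F.1 ∧ c F = true}.ncard : ℤ) -
        ({F : K.facets | IsOddSimplex F.1 ∧ c F = false}.ncard : ℤ))

/-- The set of the signatures of all rdf-triangulations of `P`. -/
def rdfSignatures {m : ℕ} (P : Set (Fin m → ℝ)) : Set ℕ :=
  {s | ∃ K : Geometry.SimplicialComplex ℝ (Fin m → ℝ), IsRDFTriangulation K P ∧ HasSignature K s}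

/-- The signature `σ(P)` of a lattice polytope `P`: the maximum of the signatures of all its
rdf-triangulations (meaningful only if this maximum exists). -/
noncomputable def signature {m : ℕ} (P : Set (Fin m → ℝ)) : ℕ :=
  sSup (rdfSignatures P)

/-- The `d`-cube `C_d = [0,1]^d`. -/
def cube (d : ℕ) : Set (Fin d → ℝ) := Set.Icc 0 1

end CubeSignature

/-! Signatures multiply under a suitable product of triangulations, and a few small cubes supply the
factors. A triangulation is encoded as a list of `0`/`1`-simplices with vertices ordered by colour
and a lift certifying each simplex as a lower facet. Lower facets meet face to face, so they
triangulate the cube as soon as their volumes `|det| / d!` add up to 1 (`IsRegularCover`). With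
vertices ordered by colour, the determinant changes sign between adjacent facets, so the signature
is the absolute sum of the signs of the odd determinants (`IsRegularCover.mem_rdfSignatures`).

A product of two such triangulations is a subdivision into products of simplices. These are refined
compatibly by a rule that sees a vertex of the first factor only through its colour
(`IsLocalModel`); determinants, hence odd signs, then multiply
(`IsLocalModel.sum_oddSign_prodFamily`). In the staircase refinement simplices are lattice paths and
their signs are shuffle signs, generated by `∏ (X + (-1)^x) = (X² - 1)^r (X + 1)^ε`. So an
`m`-simplex times a `2k`-simplex has signed count `± r.choose k`, where `m + 2k = 2r + ε`
(`Shuffle.natAbs_sum_det`).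

In odd dimension one starts from signature 4 of the 3-cube and multiplies by the square, whose two
triangles reinforce each other thanks to a shift of labels (`HasCover.add_two`). In even dimension
they would cancel, so one multiplies by a 4-cube of signature 2 (`HasCover.add_four`), starting from
that 4-cube or from a 6-cube of signature 4 built with a special local model (`hasCover_six`). The
maximum is attained because signatures are bounded. -/

open MeasureTheory
open scoped Pointwise
namespace CubeSignature

/-! ### Volume of the corner simplex. -/

/-- The corner simplex `{x ≥ 0, ∑ x ≤ 1}`. -/
def cornerSimplex (d : ℕ) : Set (Fin d → ℝ) := {x | (∀ i, 0 ≤ x i) ∧ ∑ i, x i ≤ 1}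

lemma measurableSet_cornerSimplex (d : ℕ) : MeasurableSet (cornerSimplex d) := by
  have : IsClosed (cornerSimplex d) := by
    rw [cornerSimplex, Set.ofPred_and, Set.ofPred_forall]
    exact (isClosed_iInter fun i => isClosed_le continuous_const (continuous_apply i)).inter
      (isClosed_le (by fun_prop) continuous_const)
  exact this.measurableSet

lemma cornerSimplex_succ_slice (d : ℕ) (t : ℝ) :
    {y : Fin d → ℝ | (Fin.cons t y : Fin (d + 1) → ℝ) ∈ cornerSimplex (d + 1)} =
      if 0 ≤ t ∧ t < 1 then (1 - t) • cornerSimplex d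
      else if t = 1 then {0} else ∅ := by
  ext y
  have key : y ∈ {y : Fin d → ℝ | (Fin.cons t y : Fin (d + 1) → ℝ) ∈ cornerSimplex (d + 1)} ↔
      0 ≤ t ∧ (∀ i, 0 ≤ y i) ∧ t + ∑ i, y i ≤ 1 := by
    simp only [cornerSimplex, Set.mem_ofPred_eq, Fin.forall_fin_succ, Fin.cons_zero, Fin.cons_succ,
      Fin.sum_univ_succ, and_assoc]
  rw [key]
  split_ifs with h h'
  · have h1 : 0 < 1 - t := by linarith [h.2]
    rw [Set.mem_smul_set_iff_inv_smul_mem₀ h1.ne']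
    simp only [cornerSimplex, Set.mem_ofPred_eq, Pi.smul_apply, smul_eq_mul, ← Finset.mul_sum]
    constructor
    · rintro ⟨-, h2, h3⟩
      refine ⟨fun i => mul_nonneg (inv_nonneg.2 h1.le) (h2 i), ?_⟩
      rw [inv_mul_le_iff₀ h1]; linarith
    · rintro ⟨h2, h3⟩
      rw [inv_mul_le_iff₀ h1] at h3
      refine ⟨h.1, fun i => ?_, by linarith⟩
      have := h2 i
      rwa [mul_nonneg_iff_of_pos_left (inv_pos.2 h1)] at this
  · subst h'
    simp only [Set.mem_singleton_iff]
    constructor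
    · rintro ⟨-, h2, h3⟩
      have h4 : ∑ i, y i = 0 := le_antisymm (by linarith) (Finset.sum_nonneg fun i _ => h2 i)
      rw [Finset.sum_eq_zero_iff_of_nonneg fun i _ => h2 i] at h4
      funext i; exact h4 i (Finset.mem_univ i)
    · rintro rfl; simp
  · simp only [Set.mem_empty_iff_false, iff_false]
    rintro ⟨h2, h3, h4⟩
    have := Finset.sum_nonneg fun i (_ : i ∈ Finset.univ) => h3 i
    rcases lt_or_eq_of_le (show t ≤ 1 by linarith) with h5 | h5
    · exact h ⟨h2, h5⟩
    · exact h' h5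

/-- Fubini in the first coordinate: the slice at `t` is a copy of the lower-dimensional corner
scaled by `1 - t`, and `∫ (1 - t)^d / d! = 1 / (d + 1)!`. -/
lemma volume_cornerSimplex (d : ℕ) :
    volume (cornerSimplex d) = ENNReal.ofReal (1 / (d.factorial : ℝ)) := by
  induction d with
  | zero =>
    have : cornerSimplex 0 = Set.univ := by ext x; simp [cornerSimplex]
    rw [this]; simp [volume_pi]
  | succ d ih =>
    have hmp := (volume_preserving_piFinSuccAbove (fun _ : Fin (d + 1) => ℝ) 0).symm
    have hm := measurableSet_cornerSimplex (d + 1)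
    rw [← hmp.measure_preimage hm.nullMeasurableSet, Measure.volume_eq_prod,
      Measure.prod_apply (hmp.measurable hm)]
    have hslice : ∀ᵐ t : ℝ, volume (Prod.mk t ⁻¹'
        ((MeasurableEquiv.piFinSuccAbove (fun _ : Fin (d + 1) => ℝ) 0).symm ⁻¹'
          cornerSimplex (d + 1))) =
        (Set.Icc (0 : ℝ) 1).indicator
          (fun t => ENNReal.ofReal ((1 - t) ^ d * (1 / (d.factorial : ℝ)))) t := by
      have hne : ∀ᵐ t : ℝ, t ≠ 1 := by simp [ae_iff]
      filter_upwards [hne] with t ht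
      have h1 : (Prod.mk t ⁻¹' ((MeasurableEquiv.piFinSuccAbove (fun _ : Fin (d + 1) => ℝ) 0).symm ⁻¹'
          cornerSimplex (d + 1))) =
          {y : Fin d → ℝ | (Fin.cons t y : Fin (d + 1) → ℝ) ∈ cornerSimplex (d + 1)} := by
        ext y
        simp [MeasurableEquiv.piFinSuccAbove, Fin.insertNthEquiv]
      rw [h1, cornerSimplex_succ_slice]
      by_cases h : 0 ≤ t ∧ t < 1
      · have hmem : t ∈ Set.Icc (0 : ℝ) 1 := ⟨h.1, h.2.le⟩
        rw [if_pos h, Measure.addHaar_smul, ih, Set.indicator_of_mem hmem,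
          ← ENNReal.ofReal_mul (abs_nonneg _)]
        have : 0 ≤ 1 - t := by linarith [h.2]
        simp [abs_of_nonneg this]
      · rw [if_neg h, if_neg ht, Set.indicator_of_notMem, measure_empty]
        rintro ⟨h2, h3⟩
        exact h ⟨h2, lt_of_le_of_ne h3 ht⟩
    rw [lintegral_congr_ae hslice, lintegral_indicator measurableSet_Icc,
      ← ofReal_integral_eq_lintegral_ofReal]
    · congr 1
      rw [integral_Icc_eq_integral_Ioc, ← intervalIntegral.integral_of_le zero_le_one,
        intervalIntegral.integral_mul_const,
        intervalIntegral.integral_comp_sub_left (fun x => x ^ d) 1, integral_pow]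
      rw [Nat.factorial_succ]
      push_cast
      field_simp
      simp
    · exact Continuous.integrableOn_Icc (by fun_prop)
    · filter_upwards [ae_restrict_mem measurableSet_Icc] with t ht
      have : 0 ≤ 1 - t := by linarith [ht.2]
      positivity


/-! ### Determinants and volumes of simplices with `0`/`1` vertices. -/

lemma mem_convexHull_range {ι E : Type*} [Fintype ι] [AddCommGroup E] [Module ℝ E] {p : ι → E}
    {x : E} : x ∈ convexHull ℝ (Set.range p) ↔
      ∃ w : ι → ℝ, (∀ i, 0 ≤ w i) ∧ ∑ i, w i = 1 ∧ ∑ i, w i • p i = x := by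
  classical
  have h : convexHull ℝ (Set.range p) = Fintype.linearCombination ℝ p '' stdSimplex ℝ ι := by
    rw [← convexHull_basis_eq_stdSimplex, LinearMap.image_convexHull, ← Set.range_comp]
    congr 2
    ext i
    simp [Fintype.linearCombination_apply]
  rw [h]
  simp only [Set.mem_image, stdSimplex, Set.mem_ofPred_eq, Fintype.linearCombination_apply,
    and_assoc]

/-- The vertex of the cube with the given `0`/`1` coordinates. -/
def pt {d : ℕ} (v : Fin d → Bool) : Fin d → ℝ := fun i => if v i then 1 else 0

lemma pt_injective {d : ℕ} : Function.Injective (pt (d := d)) := by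
  intro v w h
  funext i
  have := congrFun h i
  simp only [pt] at this
  cases hv : v i <;> cases hw : w i <;> simp_all

/-- The homogeneous coordinates of the points of a simplex, as rows. -/
def homMatrix {d : ℕ} (V : Fin (d + 1) → Fin d → Bool) : Matrix (Fin (d + 1)) (Fin (d + 1)) ℤ :=
  Matrix.of fun k => Fin.cons 1 fun j => (V k j).toInt

/-- The edge vectors of a simplex at its first vertex, as rows. -/
def edgeMatrix {d : ℕ} (V : Fin (d + 1) → Fin d → Bool) : Matrix (Fin d) (Fin d) ℤ :=
  Matrix.of fun k j => (V k.succ j).toInt - (V 0 j).toInt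

/-- Subtract row 0 from the other rows and expand along the first column. -/
lemma det_cons_one {R : Type*} [CommRing R] {d : ℕ} (A : Fin (d + 1) → Fin d → R) :
    (Matrix.of fun k => (Fin.cons 1 (A k) : Fin (d + 1) → R)).det =
      (Matrix.of fun (k : Fin d) j => A k.succ j - A 0 j).det := by
  have h := Matrix.det_eq_of_forall_row_eq_smul_add_const
    (A := Matrix.of fun k => (Fin.cons 1 (A k) : Fin (d + 1) → R))
    (B := Matrix.of fun k => (Fin.cases (Fin.cons 1 (A 0)) (fun i => Fin.cons 0 (A i.succ - A 0)) k :
      Fin (d + 1) → R)) (Fin.cons 0 fun _ => 1) 0 (by simp) (by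
      intro i j
      refine Fin.cases ?_ (fun i => ?_) i <;> refine Fin.cases ?_ (fun j => ?_) j <;> simp)
  rw [h, Matrix.det_succ_column_zero, Fin.sum_univ_succ]
  simp only [Matrix.of_apply, Fin.cases_zero, Fin.cons_zero, Fin.cases_succ, mul_zero, zero_mul,
    Finset.sum_const_zero, add_zero, Fin.val_zero, pow_zero, one_mul]
  congr 1

lemma det_homMatrix {d : ℕ} (V : Fin (d + 1) → Fin d → Bool) :
    (homMatrix V).det = (edgeMatrix V).det :=
  det_cons_one _

lemma toInt_eq_pt {d : ℕ} (v : Fin d → Bool) (j : Fin d) : (((v j).toInt : ℤ) : ℝ) = pt v j := by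
  cases h : v j <;> simp [pt, h]

lemma homMatrix_map {d : ℕ} (V : Fin (d + 1) → Fin d → Bool) :
    (homMatrix V).map (Int.cast : ℤ → ℝ) =
      Matrix.of fun k => (Fin.cons 1 (pt (V k)) : Fin (d + 1) → ℝ) := by
  ext k j
  refine Fin.cases ?_ (fun j => ?_) j
  · simp [homMatrix]
  · simp [homMatrix, toInt_eq_pt]

lemma det_homMatrix_cast {d : ℕ} (V : Fin (d + 1) → Fin d → Bool) :
    (((homMatrix V).det : ℤ) : ℝ) =
      (Matrix.of fun k => (Fin.cons 1 (pt (V k)) : Fin (d + 1) → ℝ)).det := by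
  rw [← homMatrix_map]
  exact (Int.castRingHom ℝ).map_det _

lemma affineIndependent_of_det_ne_zero {d : ℕ} {V : Fin (d + 1) → Fin d → Bool}
    (h : (homMatrix V).det ≠ 0) : AffineIndependent ℝ fun k => pt (V k) := by
  rw [affineIndependent_iff]
  intro s w hw hp
  have hdet : (Matrix.of fun k => (Fin.cons 1 (pt (V k)) : Fin (d + 1) → ℝ)).det ≠ 0 := by
    rw [← det_homMatrix_cast]; exact_mod_cast h
  set w' : Fin (d + 1) → ℝ := fun k => if k ∈ s then w k else 0 with hw'
  have h0 : w' = 0 := by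
    apply Matrix.eq_zero_of_vecMul_eq_zero hdet
    funext j
    refine Fin.cases ?_ (fun j => ?_) j
    · simp [Matrix.vecMul, dotProduct, hw', hw]
    · have := congrFun hp j
      simp only [Finset.sum_apply, Pi.smul_apply, smul_eq_mul, Pi.zero_apply] at this
      simp [Matrix.vecMul, dotProduct, hw', this]
  intro e he
  have := congrFun h0 e
  simpa [hw', he] using this

/-- The vertex set of a simplex. -/
noncomputable def simplex {d : ℕ} (V : Fin (d + 1) → Fin d → Bool) : Finset (Fin d → ℝ) :=
  Finset.univ.image fun k => pt (V k)

lemma coe_simplex {d : ℕ} (V : Fin (d + 1) → Fin d → Bool) :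
    (simplex V : Set (Fin d → ℝ)) = Set.range fun k => pt (V k) := by
  simp [simplex]

lemma convexHull_simplex {d : ℕ} (V : Fin (d + 1) → Fin d → Bool) :
    convexHull ℝ (simplex V : Set (Fin d → ℝ)) =
      (fun x => pt (V 0) + x) '' (Matrix.toLin' ((edgeMatrix V).map (Int.cast : ℤ → ℝ)).transpose ''
        cornerSimplex d) := by
  rw [coe_simplex]
  ext x
  rw [mem_convexHull_range]
  have key : ∀ y : Fin d → ℝ,
      pt (V 0) + Matrix.toLin' ((edgeMatrix V).map (Int.cast : ℤ → ℝ)).transpose y =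
        (1 - ∑ i, y i) • pt (V 0) + ∑ i, y i • pt (V i.succ) := by
    intro y
    funext j
    simp only [Matrix.toLin'_apply, Matrix.mulVec, dotProduct, Matrix.transpose_apply,
      Matrix.map_apply, edgeMatrix, Matrix.of_apply, Int.cast_sub, toInt_eq_pt, Pi.add_apply,
      Pi.smul_apply, Finset.sum_apply, smul_eq_mul]
    simp only [sub_mul, Finset.sum_sub_distrib, ← Finset.mul_sum]
    simp only [mul_comm (pt (V _) j)]
    ring
  simp only [Set.mem_image, exists_exists_and_eq_and, key]
  constructor
  · rintro ⟨w, h0, h1, rfl⟩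
    rw [Fin.sum_univ_succ] at h1
    refine ⟨fun i => w i.succ, ⟨fun i => h0 _, by linarith [h0 0]⟩, ?_⟩
    rw [Fin.sum_univ_succ (f := fun i => w i • pt (V i))]
    congr 2
    linarith
  · rintro ⟨y, ⟨h0, h1⟩, rfl⟩
    refine ⟨Fin.cons (1 - ∑ i, y i) y, ?_, ?_, ?_⟩
    · intro i
      refine Fin.cases ?_ (fun i => ?_) i
      · simpa using h1
      · simpa using h0 i
    · simp [Fin.sum_univ_succ]
    · simp [Fin.sum_univ_succ]

lemma volume_simplex {d : ℕ} (V : Fin (d + 1) → Fin d → Bool) :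
    volume (convexHull ℝ (simplex V : Set (Fin d → ℝ))) =
      ENNReal.ofReal (|((homMatrix V).det : ℝ)| / d.factorial) := by
  rw [convexHull_simplex, Set.image_add_left, measure_preimage_add,
    Measure.addHaar_image_linearMap, volume_cornerSimplex, LinearMap.det_toLin',
    Matrix.det_transpose, ← ENNReal.ofReal_mul (abs_nonneg _), det_homMatrix]
  congr 1
  rw [show ((edgeMatrix V).map (Int.cast : ℤ → ℝ)).det = ((edgeMatrix V).det : ℝ) from
    ((Int.castRingHom ℝ).map_det _).symm]
  ring

lemma normalizedVolume_simplex {d : ℕ} (V : Fin (d + 1) → Fin d → Bool) :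
    normalizedVolume (convexHull ℝ (simplex V : Set (Fin d → ℝ))) =
      ((|(homMatrix V).det| : ℤ) : ℝ) := by
  rw [normalizedVolume, Measure.real, volume_simplex, ENNReal.toReal_ofReal (by positivity)]
  have : (d.factorial : ℝ) ≠ 0 := by positivity
  rw [Int.cast_abs]
  field_simp

lemma isOddSimplex_simplex {d : ℕ} (V : Fin (d + 1) → Fin d → Bool) :
    IsOddSimplex (simplex V) ↔ Odd (homMatrix V).det := by
  rw [IsOddSimplex, normalizedVolume_simplex]
  constructor
  · rintro ⟨k, hk, h⟩
    rw [← Int.cast_inj.1 h] at hk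
    exact odd_abs.1 hk
  · intro h
    exact ⟨_, odd_abs.2 h, rfl⟩


/-! ### Simplicial complexes from lower facets of a lift. -/

section LowerSystem

variable {E : Type*} [AddCommGroup E] [Module ℝ E] {ι : Type*}

lemma affineMap_sum {κ : Type*} (a : E →ᵃ[ℝ] ℝ) (t : Finset κ) (w : κ → ℝ) (p : κ → E)
    (hw : ∑ v ∈ t, w v = 1) : a (∑ v ∈ t, w v • p v) = ∑ v ∈ t, w v * a (p v) := by
  have h : ∀ x, a x = a.linear x + a 0 := fun x => by
    have := a.map_vadd 0 x
    simpa using this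
  rw [h, map_sum]
  simp only [map_smul, smul_eq_mul]
  have h' : ∀ v, w v * a (p v) = w v * a.linear (p v) + w v * a 0 := fun v => by
    rw [h (p v), mul_add]
  simp only [h', Finset.sum_add_distrib, ← Finset.sum_mul, hw, one_mul]

/-- A family of simplices `s i` with vertices in `X`, each of which is cut out of the graph of the
lifting function `L` on `X` by a supporting non-vertical hyperplane, the graph of `a i`. -/
structure IsLowerSystem (X : Set E) (L : E → ℝ) (s : ι → Finset E) (a : ι → E →ᵃ[ℝ] ℝ) :
    Prop where
  subset : ∀ i, (s i : Set E) ⊆ X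
  indep : ∀ i, AffineIndependent ℝ ((↑) : s i → E)
  map_eq : ∀ i, ∀ v ∈ s i, a i v = L v
  map_lt : ∀ i, ∀ v ∈ X, v ∉ s i → a i v < L v

variable {X : Set E} {L : E → ℝ} {s : ι → Finset E} {a : ι → E →ᵃ[ℝ] ℝ}

namespace IsLowerSystem

lemma map_le (h : IsLowerSystem X L s a) (i : ι) {v : E} (hv : v ∈ X) : a i v ≤ L v := by
  by_cases hs : v ∈ s i
  · exact (h.map_eq i v hs).le
  · exact (h.map_lt i v hv hs).le

lemma mem_iff (h : IsLowerSystem X L s a) (i : ι) {v : E} (hv : v ∈ X) :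
    v ∈ s i ↔ a i v = L v :=
  ⟨h.map_eq i v, fun he => by_contra fun hs => (h.map_lt i v hv hs).ne he⟩

/-- Points of `t` that contribute to a point on the `i`-th hyperplane belong to `s i`. -/
lemma mem_of_sum_le (h : IsLowerSystem X L s a) (i : ι) {t : Finset E} (ht : (t : Set E) ⊆ X)
    {w : E → ℝ} (h0 : ∀ v ∈ t, 0 ≤ w v) (h1 : ∑ v ∈ t, w v = 1)
    (hle : ∑ v ∈ t, w v * L v ≤ a i (∑ v ∈ t, w v • v)) {v : E} (hv : v ∈ t) (hwv : w v ≠ 0) :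
    v ∈ s i := by
  rw [affineMap_sum (a i) t w (fun v => v) h1] at hle
  have hle' : ∀ v ∈ t, w v * a i v ≤ w v * L v := fun v hv =>
    mul_le_mul_of_nonneg_left (h.map_le i (ht hv)) (h0 v hv)
  have heq := (Finset.sum_eq_sum_iff_of_le hle').1 (le_antisymm (Finset.sum_le_sum hle') hle) v hv
  exact (h.mem_iff i (ht hv)).2 (mul_left_cancel₀ hwv heq)

/-- The supporting function of a simplex dominates all the others over that simplex. Hence two of
them agree over an intersection, which controls both face-to-face meeting and volumes of overlaps.
-/
lemma map_le_map (h : IsLowerSystem X L s a) (i j : ι) {x : E}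
    (hx : x ∈ convexHull ℝ (s i : Set E)) : a j x ≤ a i x := by
  rw [Finset.mem_convexHull'] at hx
  obtain ⟨w, h0, h1, rfl⟩ := hx
  rw [affineMap_sum _ _ w (fun v => v) h1, affineMap_sum _ _ w (fun v => v) h1]
  refine Finset.sum_le_sum fun v hv => mul_le_mul_of_nonneg_left ?_ (h0 v hv)
  rw [h.map_eq i v hv]
  exact h.map_le j (h.subset i hv)

/-- Complementary slackness: at a common point `a i ≤ a j`, so the weights of its representation
over `t` live on vertices of `s j`. Both representations are then inside the single simplex `s j`,
where affine independence applies. -/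
lemma inter_subset [DecidableEq E] (h : IsLowerSystem X L s a) {i j : ι} {t u : Finset E}
    (ht : t ⊆ s i) (hu : u ⊆ s j) :
    convexHull ℝ (t : Set E) ∩ convexHull ℝ (u : Set E) ⊆ convexHull ℝ (t ∩ u : Set E) := by
  rintro x ⟨hxt, hxu⟩
  have hij : a i x ≤ a j x :=
    h.map_le_map j i (convexHull_mono (Finset.coe_subset.2 hu) hxu)
  have hxt' : x ∈ convexHull ℝ ((t ∩ s j : Finset E) : Set E) := by
    rw [Finset.mem_convexHull'] at hxt ⊢
    obtain ⟨w, h0, h1, rfl⟩ := hxt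
    have hzero : ∀ v ∈ t, v ∉ t ∩ s j → w v = 0 := by
      intro v hv hv'
      by_contra hw
      refine hv' (Finset.mem_inter.2 ⟨hv, h.mem_of_sum_le j
        (fun v hv => h.subset i (ht hv)) h0 h1 ?_ hv hw⟩)
      refine le_trans (le_of_eq ?_) hij
      rw [affineMap_sum _ _ w (fun v => v) h1]
      exact Finset.sum_congr rfl fun v hv => by rw [h.map_eq i v (ht hv)]
    refine ⟨w, fun v hv => h0 v (Finset.mem_inter.1 hv).1, ?_, ?_⟩
    · rw [Finset.sum_subset Finset.inter_subset_left hzero, h1]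
    · exact Finset.sum_subset Finset.inter_subset_left fun v hv hv' => by rw [hzero v hv hv', zero_smul]
  have := (h.indep j).convexHull_inter (Finset.inter_subset_right : t ∩ s j ⊆ s j) hu
  have hx : x ∈ convexHull ℝ (((t ∩ s j : Finset E) : Set E) ∩ (u : Set E)) := by
    rw [this]; exact ⟨hxt', hxu⟩
  refine convexHull_mono ?_ hx
  rintro v ⟨hv, hv'⟩
  exact ⟨(Finset.mem_inter.1 hv).1, hv'⟩

/-- The simplicial complex of all the faces of the simplices of a lower system. -/
def complex (h : IsLowerSystem X L s a) : Geometry.SimplicialComplex ℝ E where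
  faces := {t | t.Nonempty ∧ ∃ i, t ⊆ s i}
  isRelLowerSet_faces := by
    rintro t ⟨ht, i, hi⟩
    exact ⟨ht, fun u hu hun => ⟨hun, i, hu.trans hi⟩⟩
  indep := by
    rintro t ⟨-, i, hi⟩
    exact (h.indep i).mono hi
  inter_subset_convexHull := by
    classical
    rintro t u ⟨-, i, hi⟩ ⟨-, j, hj⟩
    exact h.inter_subset hi hj

lemma mem_complex_faces (h : IsLowerSystem X L s a) {t : Finset E} :
    t ∈ h.complex.faces ↔ t.Nonempty ∧ ∃ i, t ⊆ s i := Iff.rfl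

lemma mem_complex_vertices (h : IsLowerSystem X L s a) {v : E} :
    v ∈ h.complex.vertices ↔ ∃ i, v ∈ s i := by
  rw [Geometry.SimplicialComplex.mem_vertices, mem_complex_faces]
  simp

lemma complex_space (h : IsLowerSystem X L s a) :
    h.complex.space = ⋃ i, convexHull ℝ (s i : Set E) := by
  ext x
  rw [Geometry.SimplicialComplex.mem_space_iff, Set.mem_iUnion]
  constructor
  · rintro ⟨t, ⟨-, i, hi⟩, hx⟩
    exact ⟨i, convexHull_mono (Finset.coe_subset.2 hi) hx⟩
  · rintro ⟨i, hx⟩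
    refine ⟨s i, ⟨?_, i, Finset.Subset.refl _⟩, hx⟩
    exact Finset.coe_nonempty.1 (convexHull_nonempty_iff.1 ⟨x, hx⟩)

lemma finite_complex_faces [Finite ι] (h : IsLowerSystem X L s a) : h.complex.faces.Finite := by
  have : h.complex.faces ⊆ ⋃ i, ((s i).powerset : Set (Finset E)) := by
    rintro t ⟨-, i, hi⟩
    exact Set.mem_iUnion.2 ⟨i, by simpa using hi⟩
  exact (Set.finite_iUnion fun i => (s i).powerset.finite_toSet).subset this

lemma complex_facets (h : IsLowerSystem X L s a) {n : ℕ} (hn : ∀ i, (s i).card = n + 1) :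
    h.complex.facets = Set.range s := by
  ext t
  rw [Geometry.SimplicialComplex.mem_facets]
  constructor
  · rintro ⟨⟨-, i, hi⟩, hmax⟩
    refine ⟨i, (hmax (s i) ⟨?_, i, Finset.Subset.refl _⟩ hi).symm⟩
    exact Finset.card_pos.1 (by rw [hn]; omega)
  · rintro ⟨i, rfl⟩
    refine ⟨⟨Finset.card_pos.1 (by rw [hn]; omega), i, Finset.Subset.refl _⟩, ?_⟩
    rintro t ⟨-, j, hj⟩ hit
    refine Finset.eq_of_subset_of_card_le hit ?_
    rw [hn i, ← hn j]
    exact Finset.card_le_card hj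

/-- A point in the union of the simplices that is a convex combination of points of a lower face
lies in a simplex containing the face. -/
lemma exists_subset_of_lowerFace (h : IsLowerSystem X L s a) {t : Finset E} (ht : t.Nonempty)
    (htX : (t : Set E) ⊆ X) {b : E →ᵃ[ℝ] ℝ} (hb : ∀ v ∈ t, b v = L v)
    (hb' : ∀ v ∈ X, b v ≤ L v)
    (hcover : convexHull ℝ X ⊆ ⋃ i, convexHull ℝ (s i : Set E)) : ∃ i, t ⊆ s i := by
  have hcard : (t.card : ℝ) ≠ 0 := by exact_mod_cast (Finset.card_pos.2 ht).ne'
  have hsum : ∑ v ∈ t, (fun _ : E => (t.card : ℝ)⁻¹) v = 1 := by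
    simp [hcard]
  -- The barycentre of `t`: all its weights are nonzero, so slackness in a simplex containing it
  -- captures every vertex of `t`.
  set x := ∑ v ∈ t, (fun _ : E => (t.card : ℝ)⁻¹) v • v with hx
  have hxX : x ∈ convexHull ℝ X := by
    refine convexHull_mono htX (Finset.mem_convexHull'.2 ⟨_, ?_, hsum, rfl⟩)
    intro v _
    positivity
  obtain ⟨i, hi⟩ := Set.mem_iUnion.1 (hcover hxX)
  refine ⟨i, fun v hv => h.mem_of_sum_le i htX (w := fun _ => (t.card : ℝ)⁻¹)
    (fun v _ => by positivity) hsum ?_ hv (inv_ne_zero hcard)⟩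
  have h1 : b x = ∑ v ∈ t, (t.card : ℝ)⁻¹ * L v := by
    rw [hx, affineMap_sum b t _ (fun v => v) hsum]
    exact Finset.sum_congr rfl fun v hv => by rw [hb v hv]
  rw [← h1, ← hx]
  rw [Finset.mem_convexHull'] at hi
  obtain ⟨w, h0, hw1, hwx⟩ := hi
  rw [← hwx, affineMap_sum b _ w (fun v => v) hw1, affineMap_sum _ _ w (fun v => v) hw1]
  refine Finset.sum_le_sum fun v hv => mul_le_mul_of_nonneg_left ?_ (h0 v hv)
  rw [h.map_eq i v hv]
  exact hb' v (h.subset i hv)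

end IsLowerSystem

end LowerSystem


/-! ### Affine interpolation, orientation, and lattice points of the cube. -/

/-- The affine function with constant term `u 0` and linear coefficients `u 1, u 2, …`. -/
noncomputable def affineOf {d : ℕ} (u : Fin (d + 1) → ℝ) : (Fin d → ℝ) →ᵃ[ℝ] ℝ :=
  (Fintype.linearCombination ℝ fun i : Fin d => u i.succ).toAffineMap +
    AffineMap.const ℝ (Fin d → ℝ) (u 0)

lemma affineOf_apply {d : ℕ} (u : Fin (d + 1) → ℝ) (x : Fin d → ℝ) :
    affineOf u x = ∑ j, (Fin.cons 1 x : Fin (d + 1) → ℝ) j * u j := by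
  simp [affineOf, Fintype.linearCombination_apply, Fin.sum_univ_succ, add_comm]

lemma exists_affineMap_eq {d : ℕ} {V : Fin (d + 1) → Fin d → Bool} (h : (homMatrix V).det ≠ 0)
    (f : Fin (d + 1) → ℝ) : ∃ g : (Fin d → ℝ) →ᵃ[ℝ] ℝ, ∀ k, g (pt (V k)) = f k := by
  set H : Matrix (Fin (d + 1)) (Fin (d + 1)) ℝ :=
    Matrix.of fun k => (Fin.cons 1 (pt (V k)) : Fin (d + 1) → ℝ) with hH
  have hdet : IsUnit H.det := by
    rw [isUnit_iff_ne_zero, hH, ← det_homMatrix_cast]; exact_mod_cast h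
  refine ⟨affineOf (H⁻¹.mulVec f), fun k => ?_⟩
  have : H.mulVec (H⁻¹.mulVec f) = f := by
    rw [Matrix.mulVec_mulVec, Matrix.mul_nonsing_inv _ hdet, Matrix.one_mulVec]
  rw [affineOf_apply]
  exact congrFun this k

/-- Replacing a vertex of a simplex by a point on the other side of the opposite facet changes the
orientation. -/
lemma det_mul_det_neg {d : ℕ} {V V' : Fin (d + 1) → Fin d → Bool} (k : Fin (d + 1))
    (hV : (homMatrix V).det ≠ 0) (heq : ∀ l, l ≠ k → V' l = V l)
    (f : (Fin d → ℝ) →ᵃ[ℝ] ℝ) (h0 : ∀ l, l ≠ k → f (pt (V l)) = 0) (hpos : 0 < f (pt (V k)))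
    (hneg : f (pt (V' k)) < 0) : (homMatrix V).det * (homMatrix V').det < 0 := by
  set H : (Fin (d + 1) → Fin d → Bool) → Matrix (Fin (d + 1)) (Fin (d + 1)) ℝ := fun V =>
    Matrix.of fun k => (Fin.cons 1 (pt (V k)) : Fin (d + 1) → ℝ) with hH
  have hdet : ∀ W, (((homMatrix W).det : ℤ) : ℝ) = (H W).det := fun W => det_homMatrix_cast W
  have hu : IsUnit (H V).det := by
    rw [isUnit_iff_ne_zero, ← hdet]; exact_mod_cast hV
  -- Barycentric coordinates of the new vertex. Both the ratio of the determinants and the ratio of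
  -- the values of `f` equal `c k`.
  set c := Matrix.vecMul (H V' k) (H V)⁻¹ with hc
  have hcr : Matrix.vecMul c (H V) = H V' k := by
    rw [hc, Matrix.vecMul_vecMul, Matrix.nonsing_inv_mul _ hu, Matrix.vecMul_one]
  have hup : H V' = (H V).updateRow k (∑ l, c l • H V l) := by
    ext l j
    by_cases hl : l = k
    · subst hl
      rw [Matrix.updateRow_self, ← hcr]
      simp [Matrix.vecMul, dotProduct]
    · rw [Matrix.updateRow_ne hl]
      simp [hH, heq l hl]
  have hdet' : (H V').det = c k • (H V).det := by
    rw [hup, Matrix.det_updateRow_sum]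
  have hc1 : ∑ l, c l = 1 := by
    have := congrFun hcr 0
    simpa [Matrix.vecMul, dotProduct, hH] using this
  have hcp : pt (V' k) = ∑ l, c l • pt (V l) := by
    funext j
    have := congrFun hcr j.succ
    simp only [Matrix.vecMul, dotProduct, hH, Matrix.of_apply, Fin.cons_succ] at this
    simp [← this]
  have hf : f (pt (V' k)) = c k * f (pt (V k)) := by
    rw [hcp, affineMap_sum f _ c (fun l => pt (V l)) hc1]
    rw [Finset.sum_eq_single k (fun l _ hl => by rw [h0 l hl, mul_zero]) (by simp)]
  have hck : c k < 0 := by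
    by_contra hcon
    rw [hf] at hneg
    exact absurd (mul_nonneg (not_lt.1 hcon) hpos.le) (not_le.2 hneg)
  have hV0 : (H V).det ≠ 0 := hu.ne_zero
  have : ((((homMatrix V).det * (homMatrix V').det : ℤ)) : ℝ) < 0 := by
    rw [Int.cast_mul, hdet, hdet, hdet', smul_eq_mul]
    nlinarith [mul_self_pos.2 hV0]
  exact_mod_cast this

lemma pt_mem_cube {d : ℕ} (v : Fin d → Bool) : pt v ∈ cube d := by
  constructor <;> intro i <;> simp only [pt] <;> split_ifs <;> simp

lemma convex_cube (d : ℕ) : Convex ℝ (cube d) := convex_Icc 0 1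

lemma convexHull_range_pt_subset (d : ℕ) :
    convexHull ℝ (Set.range (pt (d := d))) ⊆ cube d :=
  convexHull_min (by rintro _ ⟨v, rfl⟩; exact pt_mem_cube v) (convex_cube d)

lemma cube_inter_latticePoints (d : ℕ) :
    cube d ∩ latticePoints d = Set.range (pt (d := d)) := by
  ext x
  constructor
  · rintro ⟨⟨h0, h1⟩, h2⟩
    refine ⟨fun i => decide (x i = 1), ?_⟩
    funext i
    obtain ⟨z, hz⟩ := h2 i
    have h0' := h0 i
    have h1' := h1 i
    simp only [Pi.zero_apply, Pi.one_apply, hz] at h0' h1'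
    have h3 : z = 0 ∨ z = 1 := by
      have h4 : (0 : ℤ) ≤ z := by exact_mod_cast h0'
      have h5 : z ≤ 1 := by exact_mod_cast h1'
      omega
    rcases h3 with rfl | rfl <;> simp [pt, hz]
  · rintro ⟨v, rfl⟩
    refine ⟨pt_mem_cube v, fun i => ⟨(v i).toInt, (toInt_eq_pt v i).symm⟩⟩

/-- Cube vertices are extreme points, so a covering by simplices inside the cube must use each as a
vertex; this yields density. -/
lemma mem_of_pt_mem_convexHull {d : ℕ} {s : Finset (Fin d → ℝ)}
    (hs : (s : Set (Fin d → ℝ)) ⊆ cube d)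
    {v : Fin d → Bool} (hv : pt v ∈ convexHull ℝ (s : Set (Fin d → ℝ))) : pt v ∈ s := by
  have hext : pt v ∈ (convexHull ℝ (s : Set (Fin d → ℝ))).extremePoints ℝ := by
    refine inter_extremePoints_subset_extremePoints_of_subset
      (convexHull_min hs (convex_cube d)) ⟨hv, ?_⟩
    rw [cube, ← Set.pi_univ_Icc, extremePoints_pi]
    intro i _
    rw [mem_extremePoints]
    constructor
    · simp only [pt]; split_ifs <;> simp
    · rintro x ⟨hx0, hx1⟩ y ⟨hy0, hy1⟩ ⟨α, β, hα, hβ, hαβ, he⟩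
      simp only [Pi.zero_apply, Pi.one_apply, smul_eq_mul, pt] at *
      split_ifs at he ⊢
      · constructor <;> nlinarith
      · constructor <;> nlinarith
  exact extremePoints_convexHull_subset hext


/-! ### Regular covers: a numerical certificate for triangulations of the cube. -/

/-- The simplices with vertices `V i` are the facets of a regular dense triangulation of the cube:
each of them lifts to a lower facet, and their normalized volumes add up to that of the cube. -/
structure IsRegularCover {d : ℕ} {ι : Type} [Fintype ι] (V : ι → Fin (d + 1) → Fin d → Bool) :
    Prop where
  exists_lift : ∃ lift : (Fin d → Bool) → ℝ, ∀ i, ∃ a : (Fin d → ℝ) →ᵃ[ℝ] ℝ,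
    (∀ k, a (pt (V i k)) = lift (V i k)) ∧ ∀ v, (∀ k, V i k ≠ v) → a (pt v) < lift v
  det_ne_zero : ∀ i, (homMatrix (V i)).det ≠ 0
  injective : ∀ i j, Set.range (V i) = Set.range (V j) → i = j
  sum_det : ∑ i, |(homMatrix (V i)).det| = d.factorial

section

variable {d : ℕ}

/-- The `0`/`1` vector of a vertex of the cube. -/
noncomputable def bits (x : Fin d → ℝ) : Fin d → Bool := fun i => decide (x i = 1)

@[simp] lemma bits_pt (v : Fin d → Bool) : bits (pt v) = v := by
  funext i
  cases h : v i <;> simp [bits, pt, h]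

lemma mem_simplex {V : Fin (d + 1) → Fin d → Bool} {v : Fin d → Bool} :
    pt v ∈ simplex V ↔ v ∈ Set.range V := by
  simp [simplex, pt_injective.eq_iff]

lemma simplex_subset (V : Fin (d + 1) → Fin d → Bool) :
    (simplex V : Set (Fin d → ℝ)) ⊆ Set.range (pt (d := d)) := by
  rw [coe_simplex]
  rintro _ ⟨k, rfl⟩
  exact ⟨_, rfl⟩

lemma simplex_eq_iff {V W : Fin (d + 1) → Fin d → Bool} :
    simplex V = simplex W ↔ Set.range V = Set.range W := by
  constructor
  · intro h
    ext v
    rw [← mem_simplex, ← mem_simplex, h]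
  · intro h
    apply Finset.coe_injective
    rw [coe_simplex, coe_simplex]
    change Set.range (pt ∘ V) = Set.range (pt ∘ W)
    rw [Set.range_comp, Set.range_comp, h]

lemma card_simplex {V : Fin (d + 1) → Fin d → Bool} (h : (homMatrix V).det ≠ 0) :
    (simplex V).card = d + 1 := by
  rw [simplex, Finset.card_image_of_injective _ (affineIndependent_of_det_ne_zero h).injective]
  simp

lemma isClosed_convexHull_finset (s : Finset (Fin d → ℝ)) :
    IsClosed (convexHull ℝ (s : Set (Fin d → ℝ))) :=
  (s.finite_toSet.isCompact_convexHull ℝ).isClosed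

/-- The part of the open cube missed by `U` is open and null, hence empty; the cube is the closure
of its interior. -/
lemma cube_subset_of_volume {U : Set (Fin d → ℝ)} (hU : IsClosed U) (hsub : U ⊆ cube d)
    (hvol : 1 ≤ volume U) : cube d ⊆ U := by
  have hcube : volume (cube d) = 1 := by
    rw [cube, Real.volume_Icc_pi]; simp
  have hfin : volume U ≠ ⊤ := ((measure_mono hsub).trans_lt (by rw [hcube]; simp)).ne
  have hdiff : volume (cube d \ U) = 0 := by
    rw [measure_sdiff hsub hU.measurableSet.nullMeasurableSet hfin, hcube]
    exact tsub_eq_zero_of_le hvol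
  have hopen : IsOpen (interior (cube d) \ U) := isOpen_interior.sdiff hU
  have hempty : interior (cube d) \ U = ∅ := by
    rw [← hopen.measure_eq_zero_iff volume]
    exact measure_mono_null (Set.sdiff_subset_sdiff_left interior_subset) hdiff
  have hint : (interior (cube d)).Nonempty := by
    refine ⟨fun _ => 1 / 2, ?_⟩
    rw [cube, ← Set.pi_univ_Icc, interior_pi_set Set.finite_univ]
    intro i _
    simp only [Pi.zero_apply, Pi.one_apply, interior_Icc]
    constructor <;> norm_num
  have hclosed : IsClosed (cube d) := isClosed_Icc
  rw [← hclosed.closure_eq, ← (convex_cube d).closure_interior_eq_closure_of_nonempty_interior hint]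
  exact closure_minimal (Set.sdiff_eq_empty.1 hempty) hU

variable {ι : Type} [Fintype ι] {V : ι → Fin (d + 1) → Fin d → Bool}

lemma IsRegularCover.exists_isLowerSystem (h : IsRegularCover V) :
    ∃ (L : (Fin d → ℝ) → ℝ) (a : ι → (Fin d → ℝ) →ᵃ[ℝ] ℝ),
      IsLowerSystem (Set.range pt) L (fun i => simplex (V i)) a := by
  obtain ⟨lift, hl⟩ := h.exists_lift
  choose a ha using hl
  refine ⟨fun x => lift (bits x), a, ⟨fun i => simplex_subset _, fun i => ?_, fun i v hv => ?_,
    fun i v hv hv' => ?_⟩⟩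
  · have := (affineIndependent_of_det_ne_zero (h.det_ne_zero i)).range
    rw [← coe_simplex] at this
    exact this
  · obtain ⟨w, rfl⟩ := simplex_subset _ hv
    obtain ⟨k, rfl⟩ := mem_simplex.1 hv
    rw [(ha i).1, bits_pt]
  · obtain ⟨w, rfl⟩ := hv
    rw [bits_pt]
    refine (ha i).2 w fun k hk => hv' (mem_simplex.2 ⟨k, hk⟩)

lemma IsRegularCover.exists_mem_notMem (h : IsRegularCover V) {i j : ι} (hij : i ≠ j) :
    ∃ v ∈ simplex (V i), v ∉ simplex (V j) := by
  by_contra! hcon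
  have := Finset.eq_of_subset_of_card_le (s := simplex (V i)) (t := simplex (V j)) hcon
    (by rw [card_simplex (h.det_ne_zero i), card_simplex (h.det_ne_zero j)])
  exact hij (h.injective i j (simplex_eq_iff.1 this))

lemma volume_affineMap_eq (f g : (Fin d → ℝ) →ᵃ[ℝ] ℝ) {v : Fin d → ℝ} (hv : f v ≠ g v) :
    volume {x | f x = g x} = 0 := by
  have : {x | f x = g x} = (AffineSubspace.comap (f - g) (AffineSubspace.mk' 0 ⊥) :
      AffineSubspace ℝ (Fin d → ℝ)) := by
    ext x
    simp [AffineSubspace.mem_mk', sub_eq_zero]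
  rw [this]
  apply Measure.addHaar_affineSubspace
  intro htop
  have hmem : v ∈ (AffineSubspace.comap (f - g) (AffineSubspace.mk' 0 ⊥) :
      AffineSubspace ℝ (Fin d → ℝ)) := by rw [htop]; trivial
  apply hv
  rw [← SetLike.mem_coe, ← this] at hmem
  exact hmem

/-- Two distinct simplices overlap only where their distinct supporting functions agree, a null set,
so volumes add up to `d! / d! = 1`. -/
lemma IsRegularCover.iUnion_convexHull (h : IsRegularCover V) :
    ⋃ i, convexHull ℝ (simplex (V i) : Set (Fin d → ℝ)) = cube d := by
  obtain ⟨L, a, hs⟩ := h.exists_isLowerSystem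
  have hsub : ⋃ i, convexHull ℝ (simplex (V i) : Set (Fin d → ℝ)) ⊆ cube d :=
    Set.iUnion_subset fun i =>
      (convexHull_mono (simplex_subset _)).trans (convexHull_range_pt_subset d)
  refine hsub.antisymm (cube_subset_of_volume
    (isClosed_iUnion_of_finite fun i => isClosed_convexHull_finset _) hsub ?_)
  rw [measure_iUnion₀]
  · rw [tsum_fintype]
    simp only [volume_simplex]
    rw [← ENNReal.ofReal_sum_of_nonneg fun i _ => by positivity, ← Finset.sum_div]
    have hd : ∑ i, |((homMatrix (V i)).det : ℝ)| = d.factorial := by exact_mod_cast h.sum_det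
    rw [hd, div_self (by positivity)]
    simp
  · intro i j hij
    obtain ⟨v, hvi, hvj⟩ := h.exists_mem_notMem hij
    have hne : a i v ≠ a j v := by
      rw [hs.map_eq i v hvi]
      exact (hs.map_lt j v (hs.subset i hvi) hvj).ne'
    refine measure_mono_null ?_ (volume_affineMap_eq (a i) (a j) hne)
    rintro x ⟨hxi, hxj⟩
    exact le_antisymm (hs.map_le_map j i hxj) (hs.map_le_map i j hxi)
  · exact fun i => (isClosed_convexHull_finset _).measurableSet.nullMeasurableSet

end


/-! ### The signature as a signed count of odd determinants. -/

/-- The contribution of a black or white facet of signed normalized volume `z` to the signature. -/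
def oddSign (z : ℤ) : ℤ := if Odd z then z.sign else 0

lemma oddSign_mul (x y : ℤ) : oddSign (x * y) = oddSign x * oddSign y := by
  simp only [oddSign, Int.odd_mul, Int.sign_mul]
  split_ifs <;> simp_all

section

variable {d : ℕ} {ι : Type} {V : ι → Fin (d + 1) → Fin d → Bool}

/-- Ordering by colour makes adjacent facets agree in all positions but one. The function `a i - a
j` vanishes on the common wall and separates the two opposite vertices. -/
lemma det_mul_det_neg_of_adjacent {L : (Fin d → ℝ) → ℝ} {a : ι → (Fin d → ℝ) →ᵃ[ℝ] ℝ}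
    (hs : IsLowerSystem (Set.range pt) L (fun i => simplex (V i)) a)
    (hdet : ∀ i, (homMatrix (V i)).det ≠ 0) {c : (Fin d → Bool) → Fin (d + 1)}
    (hc : ∀ i k, c (V i k) = k) {i j : ι}
    (h : ((simplex (V i) : Set (Fin d → ℝ)) \ simplex (V j)).ncard = 1) :
    (homMatrix (V i)).det * (homMatrix (V j)).det < 0 := by
  obtain ⟨x, hx⟩ := Set.ncard_eq_one.1 h
  have hxmem : x ∈ (simplex (V i) : Set (Fin d → ℝ)) \ simplex (V j) := by rw [hx]; rfl
  obtain ⟨v, rfl⟩ := simplex_subset _ hxmem.1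
  obtain ⟨k, rfl⟩ := mem_simplex.1 hxmem.1
  have hag : ∀ l, l ≠ k → V j l = V i l := by
    intro l hl
    have hmem : pt (V i l) ∈ simplex (V j) := by
      by_contra hcon
      have : pt (V i l) ∈ ({pt (V i k)} : Set (Fin d → ℝ)) := by
        rw [← hx]; exact ⟨mem_simplex.2 ⟨l, rfl⟩, hcon⟩
      have := pt_injective this
      rw [← hc i l, this, hc] at hl
      exact hl rfl
    obtain ⟨l', hl'⟩ := mem_simplex.1 hmem
    have : l' = l := by rw [← hc j l', hl', hc]
    rw [← hl', this]
  have hjk : pt (V j k) ∉ simplex (V i) := by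
    intro hmem
    obtain ⟨l', hl'⟩ := mem_simplex.1 hmem
    have : l' = k := by rw [← hc i l', hl', hc]
    rw [this] at hl'
    exact hxmem.2 (mem_simplex.2 ⟨k, hl'.symm⟩)
  refine det_mul_det_neg k (hdet i) hag (a i - a j) ?_ ?_ ?_
  · intro l hl
    have h1 := hs.map_eq i (pt (V i l)) (mem_simplex.2 ⟨l, rfl⟩)
    have h2 := hs.map_eq j (pt (V i l)) (mem_simplex.2 ⟨l, hag l hl⟩)
    simp [h1, h2]
  · have h1 := hs.map_eq i (pt (V i k)) hxmem.1
    have h2 := hs.map_lt j (pt (V i k)) ⟨_, rfl⟩ hxmem.2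
    simp only [AffineMap.coe_sub, Pi.sub_apply]
    linarith
  · have h1 := hs.map_eq j (pt (V j k)) (mem_simplex.2 ⟨k, rfl⟩)
    have h2 := hs.map_lt i (pt (V j k)) ⟨_, rfl⟩ hjk
    simp only [AffineMap.coe_sub, Pi.sub_apply]
    linarith

variable [Fintype ι]

lemma IsRegularCover.vertices (h : IsRegularCover V) {L : (Fin d → ℝ) → ℝ}
    {a : ι → (Fin d → ℝ) →ᵃ[ℝ] ℝ}
    (hs : IsLowerSystem (Set.range pt) L (fun i => simplex (V i)) a) :
    hs.complex.vertices = Set.range pt := by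
  ext x
  rw [hs.mem_complex_vertices]
  constructor
  · rintro ⟨i, hi⟩
    exact simplex_subset _ hi
  · rintro ⟨v, rfl⟩
    have : pt v ∈ ⋃ i, convexHull ℝ (simplex (V i) : Set (Fin d → ℝ)) := by
      rw [h.iUnion_convexHull]; exact pt_mem_cube v
    obtain ⟨i, hi⟩ := Set.mem_iUnion.1 this
    refine ⟨i, mem_of_pt_mem_convexHull ((simplex_subset _).trans ?_) hi⟩
    rintro _ ⟨w, rfl⟩
    exact pt_mem_cube w

lemma IsRegularCover.isRegular_complex (h : IsRegularCover V) {L : (Fin d → ℝ) → ℝ}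
    {a : ι → (Fin d → ℝ) →ᵃ[ℝ] ℝ}
    (hs : IsLowerSystem (Set.range pt) L (fun i => simplex (V i)) a) :
    IsRegular hs.complex := by
  classical
  refine ⟨L, fun t => ?_⟩
  rw [hs.mem_complex_faces, IsLowerFace, h.vertices hs]
  constructor
  · rintro ⟨hne, i, hi⟩
    refine ⟨hne, fun v hv => hs.subset i (hi hv), ?_⟩
    -- Tilting `a i` by a small multiple of `g` keeps contact on `t` and breaks it at the other
    -- vertices of the simplex, so every face of a lower facet is itself a lower face.
    obtain ⟨g, hg⟩ := exists_affineMap_eq (h.det_ne_zero i)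
      fun k => if pt (V i k) ∈ t then 0 else 1
    have hsmall : ∃ ε : ℝ, 0 < ε ∧ ∀ v : Fin d → Bool, pt v ∉ simplex (V i) →
        a i (pt v) - ε * g (pt v) < L (pt v) := by
      have : ∀ᶠ ε : ℝ in nhdsWithin 0 (Set.Ioi 0), ∀ v : Fin d → Bool, pt v ∉ simplex (V i) →
          a i (pt v) - ε * g (pt v) < L (pt v) := by
        rw [Filter.eventually_all]
        intro v
        by_cases hv : pt v ∈ simplex (V i)
        · simp [hv]
        · have hlt := hs.map_lt i (pt v) ⟨v, rfl⟩ hv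
          have hcont : Filter.Tendsto (fun ε : ℝ => a i (pt v) - ε * g (pt v))
              (nhdsWithin 0 (Set.Ioi 0)) (nhds (a i (pt v) - 0 * g (pt v))) :=
            ((by fun_prop : Continuous fun ε : ℝ => a i (pt v) - ε * g (pt v)).tendsto 0).mono_left
              nhdsWithin_le_nhds
          filter_upwards [hcont.eventually (gt_mem_nhds (by simpa using hlt))] with ε hε _
          exact hε
      obtain ⟨ε, hε, hε0⟩ := (this.and self_mem_nhdsWithin).exists
      exact ⟨ε, hε0, hε⟩
    obtain ⟨ε, hε0, hε⟩ := hsmall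
    refine ⟨a i - ε • g, ?_, ?_⟩
    · intro v hv
      obtain ⟨w, rfl⟩ := simplex_subset _ (hi hv)
      obtain ⟨k, rfl⟩ := mem_simplex.1 (hi hv)
      simp [hg, hv, hs.map_eq i _ (hi hv)]
    · rintro _ ⟨v, rfl⟩ hv
      by_cases hvi : pt v ∈ simplex (V i)
      · obtain ⟨k, rfl⟩ := mem_simplex.1 hvi
        simp [hg, hv, hs.map_eq i _ hvi, hε0]
      · simpa using hε v hvi
  · rintro ⟨hne, hsub, b, hb, hb'⟩
    refine ⟨hne, hs.exists_subset_of_lowerFace hne hsub hb (fun v hv => ?_) ?_⟩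
    · by_cases hvt : v ∈ t
      · exact (hb v hvt).le
      · exact (hb' v hv hvt).le
    · rw [h.iUnion_convexHull]
      exact convexHull_range_pt_subset d

/-- A regular cover with a colouring of the vertices by positions yields an rdf-triangulation. -/
lemma IsRegularCover.mem_rdfSignatures (h : IsRegularCover V) {c : (Fin d → Bool) → Fin (d + 1)}
    (hc : ∀ i k, c (V i k) = k) :
    (∑ i, oddSign (homMatrix (V i)).det).natAbs ∈ rdfSignatures (cube d) := by
  classical
  obtain ⟨L, a, hs⟩ := h.exists_isLowerSystem
  refine ⟨hs.complex, ⟨⟨hs.finite_complex_faces, ?_⟩, h.isRegular_complex hs, ?_, ?_⟩, ?_⟩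
  · rw [hs.complex_space, h.iUnion_convexHull]
  · rw [IsDense, h.vertices hs, cube_inter_latticePoints]
  · refine ⟨fun v => c (bits v.1), ?_⟩
    rintro t ⟨-, i, hi⟩ ⟨v, pv⟩ ⟨w, pw⟩ hv hw hcol
    obtain ⟨v, rfl⟩ := simplex_subset _ (hi hv)
    obtain ⟨w, rfl⟩ := simplex_subset _ (hi hw)
    obtain ⟨k, rfl⟩ := mem_simplex.1 (hi hv)
    obtain ⟨l, rfl⟩ := mem_simplex.1 (hi hw)
    simp only [bits_pt, hc] at hcol
    simp [hcol]
  · have hfac := hs.complex_facets fun i => card_simplex (h.det_ne_zero i)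
    have hmem : ∀ i, simplex (V i) ∈ hs.complex.facets := fun i => by rw [hfac]; exact ⟨i, rfl⟩
    set e : ι → hs.complex.facets := fun i => ⟨simplex (V i), hmem i⟩ with he
    have hinj : Function.Injective e := fun i j hij =>
      h.injective i j (simplex_eq_iff.1 (Subtype.ext_iff.1 hij))
    have hsurj : Function.Surjective e := by
      rintro ⟨t, ht⟩
      obtain ⟨i, rfl⟩ := hfac ▸ ht
      exact ⟨i, rfl⟩
    set E := Equiv.ofBijective e ⟨hinj, hsurj⟩ with hE
    have hEe : ∀ i, E.symm (e i) = i := fun i => E.symm_apply_apply i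
    -- Black facets are those of positive determinant.
    refine ⟨⟨fun F => decide (0 < (homMatrix (V (E.symm F))).det), ?_⟩, ?_⟩
    · intro F G hFG
      obtain ⟨i, rfl⟩ := hsurj F
      obtain ⟨j, rfl⟩ := hsurj G
      have hneg := det_mul_det_neg_of_adjacent hs h.det_ne_zero hc hFG.1
      simp only [hEe]
      rcases mul_neg_iff.1 hneg with ⟨h1, h2⟩ | ⟨h1, h2⟩ <;> simp [h1, h2, h1.le, h2.le]
    · have hcard : ∀ b : Bool, ({F : hs.complex.facets | IsOddSimplex F.1 ∧
          decide (0 < (homMatrix (V (E.symm F))).det) = b}.ncard : ℤ) =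
          ∑ i, if Odd (homMatrix (V i)).det ∧ decide (0 < (homMatrix (V i)).det) = b
            then 1 else 0 := by
        intro b
        have : {F : hs.complex.facets | IsOddSimplex F.1 ∧
            decide (0 < (homMatrix (V (E.symm F))).det) = b} = e '' {i | Odd (homMatrix (V i)).det ∧
              decide (0 < (homMatrix (V i)).det) = b} := by
          ext F
          obtain ⟨i, rfl⟩ := hsurj F
          rw [hinj.mem_set_image]
          have hval : (e i).1 = simplex (V i) := rfl
          simp only [Set.mem_ofPred_eq, hEe, hval, isOddSimplex_simplex]
        rw [this, Set.ncard_image_of_injective _ hinj, Set.ncard_eq_toFinset_card',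
          Set.toFinset_ofPred, Finset.sum_boole]
      congr 1
      refine Eq.trans ?_ (congrArg₂ (· - ·) (hcard true) (hcard false)).symm
      rw [← Finset.sum_sub_distrib]
      refine Finset.sum_congr rfl fun i _ => ?_
      rw [oddSign]
      rcases lt_or_gt_of_ne (h.det_ne_zero i) with h1 | h1
      · simp only [Int.sign_eq_neg_one_of_neg h1, not_lt.2 h1.le]
        split_ifs <;> simp_all
      · simp only [Int.sign_eq_one_of_pos h1, h1]
        split_ifs <;> simp_all

end

/-! ### Existence of the maximum. -/

lemma finite_lattice_cube (d : ℕ) : (cube d ∩ latticePoints d).Finite := by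
  rw [cube_inter_latticePoints]; exact Set.finite_range _

lemma bddAbove_rdfSignatures (d : ℕ) : BddAbove (rdfSignatures (cube d)) := by
  refine ⟨(finite_lattice_cube d).toFinset.powerset.card, ?_⟩
  rintro s ⟨K, hK, c, rfl⟩
  have hsub : ∀ F ∈ K.faces, F ∈ (finite_lattice_cube d).toFinset.powerset := by
    intro F hF
    rw [Finset.mem_powerset]
    intro v hv
    rw [Set.Finite.mem_toFinset, ← hK.dense, K.mem_vertices]
    exact K.down_closed hF (Finset.singleton_subset_iff.2 hv) (Finset.singleton_nonempty v)
  have hle : ∀ A : Set K.facets, A.ncard ≤ (finite_lattice_cube d).toFinset.powerset.card := by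
    intro A
    rw [← Set.ncard_image_of_injective A Subtype.val_injective, ← Set.ncard_coe_finset]
    refine Set.ncard_le_ncard ?_ (Finset.finite_toSet _)
    rintro _ ⟨F, -, rfl⟩
    exact hsub _ (K.facets_subset F.2)
  have h1 := hle {F : K.facets | IsOddSimplex F.1 ∧ c F = true}
  have h2 := hle {F : K.facets | IsOddSimplex F.1 ∧ c F = false}
  omega

lemma isGreatest_signature {d : ℕ} {s : ℕ} (hs : s ∈ rdfSignatures (cube d)) :
    IsGreatest (rdfSignatures (cube d)) (signature (cube d)) ∧ s ≤ signature (cube d) :=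
  ⟨⟨Nat.sSup_mem ⟨s, hs⟩ (bddAbove_rdfSignatures d), fun _ ht =>
    le_csSup (bddAbove_rdfSignatures d) ht⟩, le_csSup (bddAbove_rdfSignatures d) hs⟩


/-! ### Products of triangulations refined by a local model. -/

section Product

variable {m n : ℕ}

/-- The vertices `0, e₁, …, e_m` of the standard corner simplex. -/
def cornerVertex (p : Fin (m + 1)) : Fin m → ℤ := fun a => if p = a.succ then 1 else 0

/-- The homogeneous coordinates of the points `P t` of a product of two corner simplices. -/
def localMatrix (P : Fin (m + n + 1) → Fin (m + 1) × Fin (n + 1)) :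
    Matrix (Fin (m + n + 1)) (Fin (m + n + 1)) ℤ :=
  Matrix.of fun t => Fin.cons 1 (Fin.append (cornerVertex (P t).1) (cornerVertex (P t).2))

/-- The points of a product of two simplices with prescribed pairs of vertices. -/
def prodVertices (v : Fin (m + 1) → Fin m → Bool) (w : Fin (n + 1) → Fin n → Bool)
    (P : Fin (m + n + 1) → Fin (m + 1) × Fin (n + 1)) : Fin (m + n + 1) → Fin (m + n) → Bool :=
  fun t => Fin.append (v (P t).1) (w (P t).2)

lemma sum_cornerVertex_mul (v : Fin (m + 1) → Fin m → Bool) (p : Fin (m + 1)) (j : Fin m) :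
    ∑ a, cornerVertex p a * edgeMatrix v a j = (v p j).toInt - (v 0 j).toInt := by
  refine Fin.cases ?_ (fun p => ?_) p
  · have : ∀ a : Fin m, cornerVertex (0 : Fin (m + 1)) a = 0 := fun a => by
      simp [cornerVertex, (Fin.succ_ne_zero a).symm]
    simp [this]
  · rw [Finset.sum_eq_single p]
    · simp [cornerVertex, edgeMatrix]
    · intro a _ ha
      simp [cornerVertex, ha.symm]
    · simp

lemma edgeMatrix_apply {d : ℕ} (V : Fin (d + 1) → Fin d → Bool) (k j : Fin d) :
    edgeMatrix V k j = (V k.succ j).toInt - (V 0 j).toInt := rfl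

/-- A product of simplices is an affine image of the product of corner simplices, with block
diagonal linear part made of the two edge matrices. -/
lemma det_homMatrix_prodVertices (v : Fin (m + 1) → Fin m → Bool) (w : Fin (n + 1) → Fin n → Bool)
    (P : Fin (m + n + 1) → Fin (m + 1) × Fin (n + 1)) :
    (homMatrix (prodVertices v w P)).det =
      (localMatrix P).det * ((homMatrix v).det * (homMatrix w).det) := by
  have hB : ((Matrix.fromBlocks (edgeMatrix v) 0 0 (edgeMatrix w)).reindex finSumFinEquiv
      finSumFinEquiv).det = (homMatrix v).det * (homMatrix w).det := by
    rw [Matrix.det_reindex_self, Matrix.det_fromBlocks_zero₂₁, det_homMatrix, det_homMatrix]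
  rw [det_homMatrix, localMatrix, det_cons_one, ← hB, ← Matrix.det_mul]
  congr 1
  ext t j
  simp only [Matrix.mul_apply, Fin.sum_univ_add, Matrix.reindex_apply, Matrix.submatrix_apply,
    Matrix.of_apply]
  rw [edgeMatrix_apply]
  refine Fin.addCases (fun j => ?_) (fun j => ?_) j
  · simp only [finSumFinEquiv_symm_apply_castAdd, finSumFinEquiv_symm_apply_natAdd,
      Matrix.fromBlocks_apply₁₁, Matrix.fromBlocks_apply₂₁, Fin.append_left, Fin.append_right,
      Matrix.zero_apply, mul_zero, Finset.sum_const_zero, add_zero, sub_mul, Finset.sum_sub_distrib]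
    rw [sum_cornerVertex_mul, sum_cornerVertex_mul]
    simp [prodVertices]
  · simp only [finSumFinEquiv_symm_apply_castAdd, finSumFinEquiv_symm_apply_natAdd,
      Matrix.fromBlocks_apply₁₂, Matrix.fromBlocks_apply₂₂, Fin.append_left, Fin.append_right,
      Matrix.zero_apply, mul_zero, Finset.sum_const_zero, zero_add, sub_mul, Finset.sum_sub_distrib]
    rw [sum_cornerVertex_mul, sum_cornerVertex_mul]
    simp [prodVertices]

/-- Compatible regular unimodular triangulations of the products of an `m`-simplex, whose vertices
are numbered, with the simplices `W g`; the simplices are given by their pairs of vertices `P g j`,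
ordered by colour. -/
structure IsLocalModel {κ J : Type} [Fintype J] (W : κ → Fin (n + 1) → Fin n → Bool)
    (P : κ → J → Fin (m + n + 1) → Fin (m + 1) × Fin (n + 1)) : Prop where
  exists_colour : ∃ γ : Fin (m + 1) → (Fin n → Bool) → Fin (m + n + 1),
    ∀ g j t, γ (P g j t).1 (W g (P g j t).2) = t
  exists_lift : ∃ ℓ : Fin (m + 1) → (Fin n → Bool) → ℝ, ∀ g j,
    ∃ (α : Fin (m + 1) → ℝ) (β : Fin (n + 1) → ℝ),
      (∀ t, α (P g j t).1 + β (P g j t).2 = ℓ (P g j t).1 (W g (P g j t).2)) ∧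
        ∀ p q, (∀ t, P g j t ≠ (p, q)) → α p + β q < ℓ p (W g q)
  injective : ∀ g, Function.Injective (P g)
  surjective_left : ∀ g j p, ∃ t, (P g j t).1 = p
  surjective_right : ∀ g j q, ∃ t, (P g j t).2 = q
  abs_det : ∀ g j, |(localMatrix (P g j)).det| = 1
  card : Fintype.card J * (m.factorial * n.factorial) = (m + n).factorial

variable {ι κ J : Type}
  {V : ι → Fin (m + 1) → Fin m → Bool} {W : κ → Fin (n + 1) → Fin n → Bool}
  {P : κ → J → Fin (m + n + 1) → Fin (m + 1) × Fin (n + 1)}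
  {c : (Fin m → Bool) → Fin (m + 1)}

/-- The simplices of the product of two triangulations, subdivided by a local model. -/
def prodFamily (V : ι → Fin (m + 1) → Fin m → Bool) (W : κ → Fin (n + 1) → Fin n → Bool)
    (P : κ → J → Fin (m + n + 1) → Fin (m + 1) × Fin (n + 1)) (x : ι × κ × J) :
    Fin (m + n + 1) → Fin (m + n) → Bool :=
  prodVertices (V x.1) (W x.2.1) (P x.2.1 x.2.2)

lemma pt_append_left (v : Fin m → Bool) (w : Fin n → Bool) :
    (fun i => pt (Fin.append v w) (Fin.castAdd n i)) = pt v := by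
  funext i; simp [pt]

lemma pt_append_right (v : Fin m → Bool) (w : Fin n → Bool) :
    (fun i => pt (Fin.append v w) (Fin.natAdd m i)) = pt w := by
  funext i; simp [pt]

lemma exists_append (x : Fin (m + n) → Bool) :
    ∃ (v : Fin m → Bool) (w : Fin n → Bool), x = Fin.append v w :=
  ⟨fun i => x (Fin.castAdd n i), fun i => x (Fin.natAdd m i), Fin.append_castAdd_natAdd.symm⟩

lemma prodFamily_apply (x : ι × κ × J) (t : Fin (m + n + 1)) :
    prodFamily V W P x t =
      Fin.append (V x.1 (P x.2.1 x.2.2 t).1) (W x.2.1 (P x.2.1 x.2.2 t).2) := rfl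

lemma append_eq_iff {v v' : Fin m → Bool} {w w' : Fin n → Bool} :
    Fin.append v w = Fin.append v' w' ↔ v = v' ∧ w = w' := by
  constructor
  · intro h
    constructor
    · funext i; simpa using congrFun h (Fin.castAdd n i)
    · funext i; simpa using congrFun h (Fin.natAdd m i)
  · rintro ⟨rfl, rfl⟩; rfl

lemma IsRegularCover.vertex_injective [Fintype ι] {d : ℕ} {V : ι → Fin (d + 1) → Fin d → Bool}
    (h : IsRegularCover V) (i : ι) : Function.Injective (V i) := fun _ _ hkl =>
  (affineIndependent_of_det_ne_zero (h.det_ne_zero i)).injective (congrArg pt hkl)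

/-- The lift is `M (liftV + liftW) + ℓ` with `M` large: the first term cuts out the products of
simplices, and `ℓ`, read off colours on the first factor, refines each of them. -/
lemma IsRegularCover.prodFamily_exists_lift [Fintype ι] [Fintype κ] [Fintype J]
    (hV : IsRegularCover V) (hc : ∀ i k, c (V i k) = k)
    (hW : IsRegularCover W) (hP : IsLocalModel W P) :
    ∃ lift : (Fin (m + n) → Bool) → ℝ, ∀ x, ∃ a : (Fin (m + n) → ℝ) →ᵃ[ℝ] ℝ,
      (∀ k, a (pt (prodFamily V W P x k)) = lift (prodFamily V W P x k)) ∧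
        ∀ v, (∀ k, prodFamily V W P x k ≠ v) → a (pt v) < lift v := by
  classical
  obtain ⟨liftV, hV'⟩ := hV.exists_lift
  obtain ⟨liftW, hW'⟩ := hW.exists_lift
  obtain ⟨ℓ, hℓ⟩ := hP.exists_lift
  choose aV haV haV' using hV'
  choose aW haW haW' using hW'
  choose α β hαβ hαβ' using hℓ
  have hA : ∀ i g j, ∃ f : (Fin m → ℝ) →ᵃ[ℝ] ℝ, ∀ k, f (pt (V i k)) = α g j k := fun i g j =>
    exists_affineMap_eq (hV.det_ne_zero i) _
  have hB : ∀ g j, ∃ f : (Fin n → ℝ) →ᵃ[ℝ] ℝ, ∀ k, f (pt (W g k)) = β g j k := fun g j =>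
    exists_affineMap_eq (hW.det_ne_zero g) _
  choose A hA using hA
  choose B hB using hB
  have hVle : ∀ i v, aV i (pt v) ≤ liftV v := fun i v => by
    by_cases h : ∃ k, V i k = v
    · obtain ⟨k, rfl⟩ := h; exact (haV i k).le
    · exact (haV' i v (not_exists.1 h)).le
  have hWle : ∀ g w, aW g (pt w) ≤ liftW w := fun g w => by
    by_cases h : ∃ k, W g k = w
    · obtain ⟨k, rfl⟩ := h; exact (haW g k).le
    · exact (haW' g w (not_exists.1 h)).le
  -- Finitely many points have a positive coarse gap; one `M` makes that gap outweigh the refinement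
  -- at all of them.
  have hM : ∀ᶠ M : ℝ in Filter.atTop, ∀ y : (ι × κ × J) × (Fin m → Bool) × (Fin n → Bool),
      0 < liftV y.2.1 - aV y.1.1 (pt y.2.1) + (liftW y.2.2 - aW y.1.2.1 (pt y.2.2)) →
      A y.1.1 y.1.2.1 y.1.2.2 (pt y.2.1) + B y.1.2.1 y.1.2.2 (pt y.2.2) - ℓ (c y.2.1) y.2.2 <
        M * (liftV y.2.1 - aV y.1.1 (pt y.2.1) + (liftW y.2.2 - aW y.1.2.1 (pt y.2.2))) := by
    rw [Filter.eventually_all]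
    intro y
    by_cases hy : 0 < liftV y.2.1 - aV y.1.1 (pt y.2.1) + (liftW y.2.2 - aW y.1.2.1 (pt y.2.2))
    · filter_upwards [(Filter.tendsto_id.atTop_mul_const hy).eventually_gt_atTop
        (A y.1.1 y.1.2.1 y.1.2.2 (pt y.2.1) + B y.1.2.1 y.1.2.2 (pt y.2.2) - ℓ (c y.2.1) y.2.2)]
        with M hM _
      exact hM
    · exact Filter.Eventually.of_forall fun M h => absurd h hy
  obtain ⟨M, hM⟩ := hM.exists
  set πl : (Fin (m + n) → ℝ) →ᵃ[ℝ] (Fin m → ℝ) :=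
    (LinearMap.funLeft ℝ ℝ (Fin.castAdd n)).toAffineMap with hπl
  set πr : (Fin (m + n) → ℝ) →ᵃ[ℝ] (Fin n → ℝ) :=
    (LinearMap.funLeft ℝ ℝ (Fin.natAdd m)).toAffineMap with hπr
  have hl : ∀ (v : Fin m → Bool) (w : Fin n → Bool), πl (pt (Fin.append v w)) = pt v :=
    fun v w => pt_append_left v w
  have hr : ∀ (v : Fin m → Bool) (w : Fin n → Bool), πr (pt (Fin.append v w)) = pt w :=
    fun v w => pt_append_right v w
  refine ⟨fun x => M * (liftV (fun i => x (Fin.castAdd n i)) + liftW (fun i => x (Fin.natAdd m i))) +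
    ℓ (c fun i => x (Fin.castAdd n i)) (fun i => x (Fin.natAdd m i)), ?_⟩
  rintro ⟨i, g, j⟩
  refine ⟨M • ((aV i).comp πl + (aW g).comp πr) + ((A i g j).comp πl + (B g j).comp πr), ?_, ?_⟩
  · intro t
    rw [prodFamily_apply]
    simp only [AffineMap.coe_add, AffineMap.coe_smul, Pi.add_apply, Pi.smul_apply,
      AffineMap.comp_apply, hl, hr, Fin.append_left, Fin.append_right, haV, haW, hA, hB, hc,
      smul_eq_mul, hαβ]
  · intro x hx
    obtain ⟨v, w, rfl⟩ := exists_append x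
    simp only [AffineMap.coe_add, AffineMap.coe_smul, Pi.add_apply, Pi.smul_apply,
      AffineMap.comp_apply, hl, hr, Fin.append_left, Fin.append_right, smul_eq_mul]
    by_cases hv : ∃ p, V i p = v
    · by_cases hw : ∃ q, W g q = w
      · obtain ⟨p, rfl⟩ := hv
        obtain ⟨q, rfl⟩ := hw
        rw [haV, haW, hA, hB, hc]
        have := hαβ' g j p q fun t ht => hx t (by rw [prodFamily_apply]; simp [ht])
        linarith
      · have h1 := haW' g w (not_exists.1 hw)
        have h2 := hVle i v
        have h3 := hM ((i, g, j), v, w) (by simp only; linarith)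
        simp only at h3
        linarith
    · have h1 := haV' i v (not_exists.1 hv)
      have h2 := hWle g w
      have h3 := hM ((i, g, j), v, w) (by simp only; linarith)
      simp only at h3
      linarith

lemma range_left_prodFamily [Fintype J] (hP : IsLocalModel W P) (x : ι × κ × J) :
    (fun y : Fin (m + n) → Bool => fun i => y (Fin.castAdd n i)) ''
      Set.range (prodFamily V W P x) = Set.range (V x.1) := by
  rw [← Set.range_comp]
  ext v
  constructor
  · rintro ⟨t, rfl⟩
    exact ⟨(P x.2.1 x.2.2 t).1, by funext i; simp [prodFamily_apply]⟩
  · rintro ⟨p, rfl⟩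
    obtain ⟨t, ht⟩ := hP.surjective_left x.2.1 x.2.2 p
    exact ⟨t, by funext i; simp [prodFamily_apply, ht]⟩

lemma range_right_prodFamily [Fintype J] (hP : IsLocalModel W P) (x : ι × κ × J) :
    (fun y : Fin (m + n) → Bool => fun i => y (Fin.natAdd m i)) ''
      Set.range (prodFamily V W P x) = Set.range (W x.2.1) := by
  rw [← Set.range_comp]
  ext v
  constructor
  · rintro ⟨t, rfl⟩
    exact ⟨(P x.2.1 x.2.2 t).2, by funext i; simp [prodFamily_apply]⟩
  · rintro ⟨p, rfl⟩
    obtain ⟨t, ht⟩ := hP.surjective_right x.2.1 x.2.2 p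
    exact ⟨t, by funext i; simp [prodFamily_apply, ht]⟩

lemma det_prodFamily (x : ι × κ × J) : (homMatrix (prodFamily V W P x)).det =
    (localMatrix (P x.2.1 x.2.2)).det * ((homMatrix (V x.1)).det * (homMatrix (W x.2.1)).det) :=
  det_homMatrix_prodVertices _ _ _

lemma IsRegularCover.isRegularCover_prodFamily [Fintype ι] [Fintype κ] [Fintype J]
    (hV : IsRegularCover V) (hc : ∀ i k, c (V i k) = k)
    (hW : IsRegularCover W) (hP : IsLocalModel W P) : IsRegularCover (prodFamily V W P) where
  exists_lift := hV.prodFamily_exists_lift hc hW hP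
  det_ne_zero := by
    rintro ⟨i, g, j⟩
    rw [det_prodFamily]
    refine mul_ne_zero (fun h => ?_) (mul_ne_zero (hV.det_ne_zero i) (hW.det_ne_zero g))
    have := hP.abs_det g j
    simp_all
  injective := by
    rintro ⟨i, g, j⟩ ⟨i', g', j'⟩ h
    have h1 : i = i' := hV.injective i i' (by
      rw [← range_left_prodFamily (V := V) hP (i, g, j), h, range_left_prodFamily hP])
    have h2 : g = g' := hW.injective g g' (by
      rw [← range_right_prodFamily (V := V) hP (i, g, j), h, range_right_prodFamily hP])
    subst h1 h2
    -- Within one product cell, the colour determines the position of each vertex, so equal vertex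
    -- sets give equal lists.
    have h3 : j = j' := by
      apply hP.injective g
      funext t
      obtain ⟨γ, hγ⟩ := hP.exists_colour
      have : prodFamily V W P (i, g, j) t ∈ Set.range (prodFamily V W P (i, g, j')) := by
        rw [← h]; exact ⟨t, rfl⟩
      obtain ⟨t', ht'⟩ := this
      rw [prodFamily_apply, prodFamily_apply, append_eq_iff] at ht'
      have h4 : P g j' t' = P g j t :=
        Prod.ext (hV.vertex_injective i ht'.1) (hW.vertex_injective g ht'.2)
      have h5 : t' = t := by rw [← hγ g j' t', h4, hγ]
      rw [← h4, h5]
    rw [h3]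
  sum_det := by
    simp only [det_prodFamily, abs_mul, hP.abs_det, one_mul, Fintype.sum_prod_type,
      Finset.sum_const, Finset.card_univ, nsmul_eq_mul]
    simp only [← Finset.mul_sum, ← Finset.sum_mul, hV.sum_det, hW.sum_det]
    rw [← hP.card]
    push_cast
    ring

lemma IsLocalModel.exists_colour_prodFamily [Fintype J] (hP : IsLocalModel W P)
    (hc : ∀ i k, c (V i k) = k) :
    ∃ c' : (Fin (m + n) → Bool) → Fin (m + n + 1), ∀ x t, c' (prodFamily V W P x t) = t := by
  obtain ⟨γ, hγ⟩ := hP.exists_colour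
  refine ⟨fun x => γ (c fun i => x (Fin.castAdd n i)) (fun i => x (Fin.natAdd m i)), ?_⟩
  rintro ⟨i, g, j⟩ t
  rw [prodFamily_apply]
  simp only [Fin.append_left, Fin.append_right, hc, hγ]

lemma IsLocalModel.sum_oddSign_prodFamily [Fintype ι] [Fintype κ] [Fintype J]
    (hP : IsLocalModel W P) :
    ∑ x, oddSign (homMatrix (prodFamily V W P x)).det =
      (∑ i, oddSign (homMatrix (V i)).det) *
        ∑ g, oddSign (homMatrix (W g)).det * ∑ j, (localMatrix (P g j)).det := by
  have h : ∀ g j, oddSign (localMatrix (P g j)).det = (localMatrix (P g j)).det := fun g j => by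
    rcases (abs_eq zero_le_one).1 (hP.abs_det g j) with h | h <;> rw [h] <;> decide
  simp only [det_prodFamily, oddSign_mul, Fintype.sum_prod_type, h]
  rw [Finset.sum_mul]
  refine Finset.sum_congr rfl fun i _ => ?_
  rw [Finset.mul_sum]
  refine Finset.sum_congr rfl fun g _ => ?_
  rw [← Finset.sum_mul]
  ring

end Product


/-! ### Staircase triangulations: lattice paths and their lift. -/

section Staircase

/-- The number of values of `A` that are less than `s`. -/
def countBelow {m N : ℕ} (A : Fin m → Fin N) (s : Fin (N + 1)) : Fin (m + 1) :=
  ⟨(Finset.univ.filter fun a => (A a).castSucc < s).card,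
    Nat.lt_succ_of_le ((Finset.card_filter_le _ _).trans (by simp))⟩

lemma lt_countBelow_iff {m N : ℕ} {A : Fin m → Fin N} (hA : StrictMono A) (s : Fin (N + 1))
    (a : Fin m) : (a : ℕ) < countBelow A s ↔ (A a).castSucc < s := by
  rw [countBelow]
  constructor
  · intro h
    by_contra hs
    have hsub : (Finset.univ.filter fun a => (A a).castSucc < s) ⊆ Finset.Iio a := by
      intro b hb
      rw [Finset.mem_filter] at hb
      rw [Finset.mem_Iio]
      by_contra hba
      have := hA.monotone (not_lt.1 hba)
      exact hs (lt_of_le_of_lt (Fin.castSucc_le_castSucc_iff.2 this) hb.2)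
    have := Finset.card_le_card hsub
    rw [Fin.card_Iio] at this
    simp only at h
    omega
  · intro h
    have hsub : Finset.Iic a ⊆ Finset.univ.filter fun a => (A a).castSucc < s := by
      intro b hb
      rw [Finset.mem_filter]
      refine ⟨Finset.mem_univ b, lt_of_le_of_lt ?_ h⟩
      exact Fin.castSucc_le_castSucc_iff.2 (hA.monotone (Finset.mem_Iic.1 hb))
    have := Finset.card_le_card hsub
    rw [Fin.card_Iic] at this
    simp only
    omega

lemma countBelow_surjective {m N : ℕ} {A : Fin m → Fin N} (hA : StrictMono A) :
    Function.Surjective (countBelow A) := by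
  intro p
  refine Fin.cases ⟨0, ?_⟩ (fun a => ⟨(A a).succ, ?_⟩) p
  · ext; simp [countBelow]
  · ext
    refine le_antisymm ?_ ?_
    · by_contra hcon
      rw [not_le, Fin.val_succ] at hcon
      have hlt : (a : ℕ) + 1 < m := by
        have := (countBelow A (A a).succ).is_lt
        omega
      have h1 := (lt_countBelow_iff hA (A a).succ ⟨a + 1, hlt⟩).1 hcon
      have h2 : A a < A ⟨a + 1, hlt⟩ := hA (by rw [Fin.lt_def]; simp)
      rw [Fin.lt_def] at h1 h2
      simp at h1
      omega
    · have := (lt_countBelow_iff hA (A a).succ a).2 (Fin.castSucc_lt_succ)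
      rw [Fin.val_succ]
      omega

variable {m n : ℕ}

/-- The set of the `m` horizontal steps of a lattice path from `(0, 0)` to `(m, n)`. -/
abbrev Shuffle (m n : ℕ) : Type := {S : Finset (Fin (m + n)) // S.card = m}

namespace Shuffle

lemma card_compl (S : Shuffle m n) : (S.1ᶜ).card = n := by
  rw [Finset.card_compl, S.2, Fintype.card_fin]; omega

/-- The times of the horizontal and vertical steps. -/
def times (S : Shuffle m n) : Fin m ⊕ Fin n ≃ Fin (m + n) :=
  finSumEquivOfFinset S.2 S.card_compl

/-- The times of the horizontal steps. -/
def left (S : Shuffle m n) (a : Fin m) : Fin (m + n) := S.times (Sum.inl a)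

/-- The times of the vertical steps. -/
def right (S : Shuffle m n) (b : Fin n) : Fin (m + n) := S.times (Sum.inr b)

lemma left_strictMono (S : Shuffle m n) : StrictMono S.left := by
  intro a a' h
  simp only [left, times, finSumEquivOfFinset_inl]
  exact (S.1.orderEmbOfFin S.2).strictMono h

lemma right_strictMono (S : Shuffle m n) : StrictMono S.right := by
  intro a a' h
  simp only [right, times, finSumEquivOfFinset_inr]
  exact (S.1ᶜ.orderEmbOfFin S.card_compl).strictMono h

lemma left_ne_right (S : Shuffle m n) (a : Fin m) (b : Fin n) : S.left a ≠ S.right b :=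
  fun h => Sum.inl_ne_inr (S.times.injective h)

lemma range_left (S : Shuffle m n) : Set.range S.left = S.1 := by
  have : S.left = S.1.orderEmbOfFin S.2 := by
    funext a; simp [left, times]
  rw [this, Finset.range_orderEmbOfFin]

lemma card_filter_times (S : Shuffle m n) (p : Fin (m + n) → Prop) [DecidablePred p] :
    (Finset.univ.filter fun a => p (S.left a)).card +
      (Finset.univ.filter fun b => p (S.right b)).card = (Finset.univ.filter p).card := by
  have h : ∀ {α : Type} [Fintype α] (q : α → Prop) [DecidablePred q],
      (Finset.univ.filter q).card = ∑ x, if q x then 1 else 0 := fun q _ => by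
    rw [Finset.card_filter]
  rw [h, h, h, ← Equiv.sum_comp S.times, Fintype.sum_sum_type]
  rfl

/-- The lattice path of a shuffle. -/
def path (S : Shuffle m n) (s : Fin (m + n + 1)) : Fin (m + 1) × Fin (n + 1) :=
  (countBelow S.left s, countBelow S.right s)

lemma path_add (S : Shuffle m n) (s : Fin (m + n + 1)) :
    ((S.path s).1 : ℕ) + (S.path s).2 = s := by
  have := S.card_filter_times fun x => x.castSucc < s
  simp only [path, countBelow]
  rw [this]
  have h2 : (Finset.univ.filter fun x : Fin (m + n) => x.castSucc < s).card =
      (Finset.univ.filter fun x : Fin (m + n) => (x : ℕ) < s).card := rfl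
  rw [h2, Fin.card_filter_val_lt]
  have := s.is_lt
  omega

lemma lt_path_fst (S : Shuffle m n) (s : Fin (m + n + 1)) (a : Fin m) :
    (a : ℕ) < (S.path s).1 ↔ (S.left a).castSucc < s := lt_countBelow_iff S.left_strictMono s a

lemma lt_path_snd (S : Shuffle m n) (s : Fin (m + n + 1)) (b : Fin n) :
    (b : ℕ) < (S.path s).2 ↔ (S.right b).castSucc < s := lt_countBelow_iff S.right_strictMono s b

lemma path_injective : Function.Injective (path (m := m) (n := n)) := by
  intro S S' h
  have hl : S.left = S'.left := by
    funext a
    have key : ∀ s, (S.left a).castSucc < s ↔ (S'.left a).castSucc < s := fun s => by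
      rw [← lt_path_fst, ← lt_path_fst, h]
    have h1 := (key (S.left a).succ).1 Fin.castSucc_lt_succ
    have h2 := (key (S'.left a).succ).2 Fin.castSucc_lt_succ
    rw [Fin.castSucc_lt_succ_iff] at h1 h2
    exact le_antisymm h2 h1
  apply Subtype.ext
  apply Finset.coe_injective
  rw [← range_left, ← range_left, hl]

/-- The number of unit cells between a lattice point and a lattice path. -/
noncomputable def slack (S : Shuffle m n) (p q : ℕ) : ℝ :=
  ∑ a : Fin m, ∑ b : Fin n,
    ((if (a : ℕ) < p ∧ q ≤ b ∧ S.right b < S.left a then 1 else 0) +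
      (if p ≤ a ∧ (b : ℕ) < q ∧ S.left a < S.right b then 1 else 0))

lemma slack_path (S : Shuffle m n) (s : Fin (m + n + 1)) :
    S.slack (S.path s).1 (S.path s).2 = 0 := by
  refine Finset.sum_eq_zero fun a _ => Finset.sum_eq_zero fun b _ => ?_
  have hl := S.lt_path_fst s a
  have hr := S.lt_path_snd s b
  rw [if_neg, if_neg, add_zero]
  · rintro ⟨h1, h2, h3⟩
    rw [← not_lt, hl, not_lt] at h1
    exact absurd (Fin.castSucc_lt_castSucc_iff.2 h3) (not_lt.2 ((hr.1 h2).le.trans h1))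
  · rintro ⟨h1, h2, h3⟩
    rw [← not_lt, hr, not_lt] at h2
    exact absurd (Fin.castSucc_lt_castSucc_iff.2 h3) (not_lt.2 ((hl.1 h1).le.trans h2))

/-- Compare `(p, q)` with the path point at time `p + q`, on the same antidiagonal. If they differ,
the cell `(p - 1, q)` or `(p, q - 1)` contributes to the slack. -/
lemma slack_pos (S : Shuffle m n) (p : Fin (m + 1)) (q : Fin (n + 1))
    (h : ∀ s, S.path s ≠ (p, q)) : 0 < S.slack p q := by
  set s : Fin (m + n + 1) := ⟨p + q, by have := p.is_lt; have := q.is_lt; omega⟩ with hs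
  have hadd := S.path_add s
  have hterm : ∀ (a : Fin m) (b : Fin n),
      (((a : ℕ) < p ∧ (q : ℕ) ≤ b ∧ S.right b < S.left a) ∨
        ((p : ℕ) ≤ a ∧ (b : ℕ) < q ∧ S.left a < S.right b)) → 0 < S.slack p q := by
    intro a b hab
    refine Finset.sum_pos' (fun a _ => Finset.sum_nonneg fun b _ => by positivity)
      ⟨a, Finset.mem_univ a, Finset.sum_pos' (fun b _ => by positivity)
        ⟨b, Finset.mem_univ b, ?_⟩⟩
    rcases hab with hab | hab
    · rw [if_pos hab]; positivity
    · rw [if_pos hab]; positivity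
  have hp := p.is_lt
  have hq := q.is_lt
  have hp' := (S.path s).1.is_lt
  have hq' := (S.path s).2.is_lt
  have hsv : (s : ℕ) = p + q := rfl
  rcases lt_trichotomy ((S.path s).1 : ℕ) p with hlt | heq | hgt
  · have h1 := mt (S.lt_path_fst s ⟨p - 1, by omega⟩).2 (by simp only; omega)
    have h2 := (S.lt_path_snd s ⟨q, by omega⟩).1 (by simp only; omega)
    refine hterm ⟨p - 1, by omega⟩ ⟨q, by omega⟩ (Or.inl ⟨by simp only; omega, le_rfl, ?_⟩)
    exact Fin.castSucc_lt_castSucc_iff.1 (h2.trans_le (not_lt.1 h1))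
  · exfalso
    refine h s (Prod.ext (Fin.ext heq) (Fin.ext ?_))
    simp only
    omega
  · have h1 := (S.lt_path_fst s ⟨p, by omega⟩).1 hgt
    have h2 := mt (S.lt_path_snd s ⟨q - 1, by omega⟩).2 (by simp only; omega)
    refine hterm ⟨p, by omega⟩ ⟨q - 1, by omega⟩ (Or.inr ⟨le_rfl, by simp only; omega, ?_⟩)
    exact Fin.castSucc_lt_castSucc_iff.1 (h1.trans_le (not_lt.1 h2))

/-- The only mixed term of the slack is `-p q`, the same for all paths. Hence the single lift `-p q`
exceeds a sum `α p + β q` by exactly the slack, and induces all the staircase simplices. -/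
lemma exists_slack_eq (S : Shuffle m n) : ∃ (α β : ℕ → ℝ), ∀ (p : Fin (m + 1)) (q : Fin (n + 1)),
    S.slack p q = -((p : ℕ) * (q : ℕ) : ℝ) - α p - β q := by
  refine ⟨fun p => -∑ a : Fin m, ∑ b : Fin n,
      if (a : ℕ) < p ∧ S.right b < S.left a then 1 else 0,
    fun q => -∑ a : Fin m, ∑ b : Fin n, if (b : ℕ) < q ∧ S.left a < S.right b then 1 else 0, ?_⟩
  intro p q
  have hcount : ∀ (k : ℕ) (p : Fin (k + 1)),
      ∑ a : Fin k, (if (a : ℕ) < p then (1 : ℝ) else 0) = (p : ℕ) := fun k p => by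
    rw [Finset.sum_boole, Fin.card_filter_val_lt]
    have := p.is_lt
    rw [min_eq_right (by omega)]
  have hpq : ((p : ℕ) * (q : ℕ) : ℝ) = ∑ a : Fin m, ∑ b : Fin n,
      (if (a : ℕ) < p then (1 : ℝ) else 0) * (if (b : ℕ) < q then (1 : ℝ) else 0) := by
    rw [← hcount m p, ← hcount n q, Finset.sum_mul_sum]
  rw [hpq, slack]
  simp only [sub_eq_add_neg, neg_neg, ← Finset.sum_neg_distrib, ← Finset.sum_add_distrib]
  refine Finset.sum_congr rfl fun a _ => Finset.sum_congr rfl fun b _ => ?_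
  have hne := S.left_ne_right a b
  have e1 : (p : ℕ) ≤ a ↔ ¬(a : ℕ) < p := not_lt.symm
  have e2 : (q : ℕ) ≤ b ↔ ¬(b : ℕ) < q := not_lt.symm
  by_cases h1 : (a : ℕ) < p <;> by_cases h2 : (b : ℕ) < q <;>
    rcases lt_or_gt_of_ne hne with h3 | h3 <;>
    simp only [e1, e2, h1, h2, h3, not_lt.2 h3.le] <;> norm_num

end Shuffle

end Staircase


/-! ### Signed count of the staircase simplices. -/

section StaircaseSign

variable {m n : ℕ}

namespace Shuffle

/-- The permutation that sorts the steps of a lattice path by direction. -/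
def perm (S : Shuffle m n) : Equiv.Perm (Fin (m + n)) := finSumFinEquiv.symm.trans S.times

lemma perm_castAdd (S : Shuffle m n) (a : Fin m) : S.perm (Fin.castAdd n a) = S.left a := by
  simp [perm, left]

lemma perm_natAdd (S : Shuffle m n) (b : Fin n) : S.perm (Fin.natAdd m b) = S.right b := by
  simp [perm, right]

lemma sum_cornerVertex_lt (k : ℕ) (p : Fin (k + 1)) (a : Fin k) :
    ∑ j, cornerVertex p j * (if a ≤ j then 1 else 0) = if (a : ℕ) < p then 1 else 0 := by
  refine Fin.cases ?_ (fun p => ?_) p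
  · have : ∀ j : Fin k, cornerVertex (0 : Fin (k + 1)) j = 0 := fun j => by
      simp [cornerVertex, (Fin.succ_ne_zero j).symm]
    simp [this]
  · rw [Finset.sum_eq_single p]
    · rw [cornerVertex, if_pos rfl, one_mul]
      refine if_congr ?_ rfl rfl
      rw [Fin.val_succ, Fin.le_def, Nat.lt_succ_iff]
    · intro j _ hj
      simp [cornerVertex, hj.symm]
    · simp

/-- The unitriangular matrix of ones. -/
def onesMatrix (k : ℕ) : Matrix (Fin k) (Fin k) ℤ := Matrix.of fun j a => if a ≤ j then 1 else 0

lemma det_onesMatrix (k : ℕ) : (onesMatrix k).det = 1 := by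
  rw [Matrix.det_of_isLowerTriangular]
  · simp [onesMatrix]
  · intro i j hij
    have : i < j := hij
    simp [onesMatrix, this]

lemma path_zero (S : Shuffle m n) : S.path 0 = (0, 0) := by
  have := S.path_add 0
  ext <;> simp at * <;> omega

/-- A unitriangular column change turns corner vertices into cumulative indicators, recording which
steps have been taken. The resulting matrix is the triangular matrix of ones with columns permuted
by `S.perm`. -/
lemma det_localMatrix_path (S : Shuffle m n) : (localMatrix S.path).det = S.perm.sign := by
  have hT : ((Matrix.fromBlocks (onesMatrix m) 0 0 (onesMatrix n)).reindex finSumFinEquiv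
      finSumFinEquiv).det = 1 := by
    rw [Matrix.det_reindex_self, Matrix.det_fromBlocks_zero₂₁, det_onesMatrix, det_onesMatrix,
      one_mul]
  have hΘ : ((onesMatrix (m + n)).submatrix id S.perm).det = S.perm.sign := by
    rw [Matrix.det_permute', det_onesMatrix, mul_one, Int.cast_id]
  rw [← hΘ, localMatrix, det_cons_one, ← mul_one (Matrix.det _), ← hT, ← Matrix.det_mul]
  congr 1
  ext t j
  have h0 : ∀ k (a : Fin k), cornerVertex (0 : Fin (k + 1)) a = 0 := fun k a => by
    simp [cornerVertex, (Fin.succ_ne_zero a).symm]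
  simp only [Matrix.mul_apply, Fin.sum_univ_add, Matrix.reindex_apply, Matrix.submatrix_apply,
    Matrix.of_apply, path_zero]
  refine Fin.addCases (fun j => ?_) (fun j => ?_) j
  · simp only [finSumFinEquiv_symm_apply_castAdd, finSumFinEquiv_symm_apply_natAdd,
      Matrix.fromBlocks_apply₁₁, Matrix.fromBlocks_apply₂₁, Fin.append_left, Fin.append_right,
      Matrix.zero_apply, mul_zero, Finset.sum_const_zero, add_zero, h0, sub_zero, id, onesMatrix,
      Matrix.of_apply, sum_cornerVertex_lt, perm_castAdd, lt_path_fst]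
    exact if_congr (Fin.castSucc_lt_succ_iff) rfl rfl
  · simp only [finSumFinEquiv_symm_apply_castAdd, finSumFinEquiv_symm_apply_natAdd,
      Matrix.fromBlocks_apply₁₂, Matrix.fromBlocks_apply₂₂, Fin.append_left, Fin.append_right,
      Matrix.zero_apply, mul_zero, Finset.sum_const_zero, zero_add, h0, sub_zero, id, onesMatrix,
      Matrix.of_apply, sum_cornerVertex_lt, perm_natAdd, lt_path_snd]
    exact if_congr (Fin.castSucc_lt_succ_iff) rfl rfl

lemma card_right_lt (S : Shuffle m n) (a : Fin m) :
    (a : ℕ) + (Finset.univ.filter fun b => S.right b < S.left a).card = S.left a := by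
  have h := S.card_filter_times fun x => x < S.left a
  have h1 : (Finset.univ.filter fun a' => S.left a' < S.left a) = Finset.Iio a := by
    ext a'
    simp [S.left_strictMono.lt_iff_lt]
  have h2 : (Finset.univ.filter fun x => x < S.left a) = Finset.Iio (S.left a) := by
    ext x; simp
  rwa [h1, h2, Fin.card_Iio, Fin.card_Iio] at h

/-- The horizontal step `a` is inverted with exactly `S.left a - a` vertical steps, and no two steps
of the same direction are inverted. -/
lemma sign_perm (S : Shuffle m n) : (S.perm.sign : ℤ) =
    (∏ a : Fin m, (-1 : ℤ) ^ (a : ℕ)) * ∏ x ∈ S.1, (-1 : ℤ) ^ (x : ℕ) := by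
  have hIoi : ∀ i : Fin (m + n), ∏ j ∈ Finset.Ioi i,
      (if S.perm i < S.perm j then (1 : ℤˣ) else -1) =
      ∏ j, if i < j then (if S.perm i < S.perm j then (1 : ℤˣ) else -1) else 1 := fun i => by
    rw [← Finset.prod_filter]
    congr 1
    ext; simp
  rw [Equiv.Perm.sign_eq_prod_prod_Ioi]
  simp only [hIoi]
  rw [Fin.prod_univ_add]
  have hright : ∀ b : Fin n, (∏ j, if Fin.natAdd m b < j then
      (if S.perm (Fin.natAdd m b) < S.perm j then (1 : ℤˣ) else -1) else 1) = 1 := by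
    intro b
    rw [Fin.prod_univ_add, Finset.prod_eq_one, Finset.prod_eq_one, one_mul]
    · intro b' _
      by_cases hb : b < b'
      · simp [perm_natAdd, hb, S.right_strictMono hb]
      · simp [hb]
    · intro a _
      rw [if_neg]
      rw [Fin.lt_def, Fin.val_natAdd, Fin.val_castAdd]
      omega
  have hleft : ∀ a : Fin m, (∏ j, if Fin.castAdd n a < j then
      (if S.perm (Fin.castAdd n a) < S.perm j then (1 : ℤˣ) else -1) else 1) =
        (-1) ^ (Finset.univ.filter fun b => S.right b < S.left a).card := by
    intro a
    rw [Fin.prod_univ_add, Finset.prod_eq_one, one_mul]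
    · rw [← Finset.prod_const, Finset.prod_filter]
      refine Finset.prod_congr rfl fun b _ => ?_
      have hlt : Fin.castAdd n a < Fin.natAdd m b := by
        rw [Fin.lt_def, Fin.val_natAdd, Fin.val_castAdd]
        omega
      rw [if_pos hlt, perm_castAdd, perm_natAdd]
      rcases lt_or_gt_of_ne (S.left_ne_right a b) with h | h
      · rw [if_pos h, if_neg (not_lt.2 h.le)]
      · rw [if_neg (not_lt.2 h.le), if_pos h]
    · intro a' _
      by_cases ha : a < a'
      · simp [perm_castAdd, S.left_strictMono ha]
      · exact if_neg ha
  simp only [hright, hleft, Finset.prod_const_one, mul_one]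
  have hS : S.1 = Finset.univ.image S.left := by
    apply Finset.coe_injective
    rw [Finset.coe_image, Finset.coe_univ, Set.image_univ, range_left]
  rw [Finset.prod_congr hS fun _ _ => rfl,
    Finset.prod_image fun a _ a' _ h => S.left_strictMono.injective h, ← Finset.prod_mul_distrib]
  push_cast
  refine Finset.prod_congr rfl fun a _ => ?_
  rw [← S.card_right_lt a, pow_add, ← mul_assoc, ← pow_add, ← two_mul, pow_mul]
  norm_num

-- The factors pair up to `(X² - 1)^r`, with one factor `X + 1` left over if `ε = 1`; its `X` only
-- reaches odd degrees.
open Polynomial in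
lemma coeff_prod_X_add_sign (r k ε : ℕ) (hε : ε < 2) :
    ((∏ x : Fin (2 * r + ε), (X + C ((-1 : ℤ) ^ (x : ℕ)))).coeff (2 * k)).natAbs = r.choose k := by
  have heven : ∏ x ∈ Finset.range (2 * r), (X + C ((-1 : ℤ) ^ x)) =
      expand ℤ 2 ((X - 1) ^ r) := by
    induction r with
    | zero => simp
    | succ r ih =>
      have h1 : (-1 : ℤ) ^ (2 * r) = 1 := by rw [pow_mul]; norm_num
      have h2 : (X + C 1) * (X + C (1 * -1)) = expand ℤ 2 (X - 1) := by
        rw [← C_1 (R := ℤ), map_sub, expand_X, expand_C]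
        simp only [one_mul, C_neg, C_1]
        ring
      rw [Nat.mul_succ, Finset.prod_range_succ, Finset.prod_range_succ, ih, pow_succ (-1 : ℤ), h1,
        mul_assoc, h2, pow_succ, map_mul]
  have hcoeff : ((expand ℤ 2 ((X - 1) ^ r)).coeff (2 * k)).natAbs = r.choose k := by
    rw [mul_comm 2 k, coeff_expand_mul (by norm_num)]
    have : (X - 1 : ℤ[X]) = X + C (-1) := by simp [sub_eq_add_neg]
    rw [this, coeff_X_add_C_pow, Int.natAbs_mul, Int.natAbs_pow]
    simp
  rw [Fin.prod_univ_eq_prod_range (fun x => X + C ((-1 : ℤ) ^ x)) (2 * r + ε)]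
  interval_cases ε
  · rw [add_zero, heven, hcoeff]
  · rw [Finset.prod_range_succ, heven, pow_mul, mul_add, coeff_add]
    have h1 : (expand ℤ 2 ((X - 1) ^ r) * X).coeff (2 * k) = 0 := by
      rcases k with _ | k
      · simp
      · rw [Nat.mul_succ, coeff_mul_X, coeff_expand (by norm_num), if_neg (by omega)]
    rw [h1, zero_add]
    simp only [even_two, Even.neg_pow, one_pow, C_1, mul_one]
    exact hcoeff

lemma natAbs_sum_det (r k ε : ℕ) (hε : ε < 2) (h : m + 2 * k = 2 * r + ε) :
    (∑ S : Shuffle m (2 * k), (localMatrix S.path).det).natAbs = r.choose k := by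
  simp only [det_localMatrix_path, sign_perm, ← Finset.mul_sum]
  rw [Int.natAbs_mul]
  have h1 : (∏ a : Fin m, (-1 : ℤ) ^ (a : ℕ)).natAbs = 1 := by
    rw [Finset.prod_pow_eq_pow_sum, Int.natAbs_pow]
    simp
  rw [h1, one_mul, ← coeff_prod_X_add_sign r k ε hε, ← h,
    Finset.prod_X_add_C_coeff _ _ (by simp)]
  congr 1
  have hm : (Finset.univ : Finset (Fin (m + 2 * k))).card - 2 * k = m := by simp
  rw [hm]
  refine (Finset.sum_subtype (Finset.powersetCard m Finset.univ) (fun S => ?_)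
    fun S : Finset (Fin (m + 2 * k)) => ∏ x ∈ S, (-1 : ℤ) ^ (x : ℕ)).symm
  simp [Finset.mem_powersetCard]

end Shuffle

end StaircaseSign


/-! ### Products of covers with staircase refinement. -/

/-- The cube `[0,1]^d` has a colourable regular cover of signature `s`. -/
def HasCover (d s : ℕ) : Prop :=
  ∃ (ι : Type) (_ : Fintype ι) (V : ι → Fin (d + 1) → Fin d → Bool)
    (c : (Fin d → Bool) → Fin (d + 1)), IsRegularCover V ∧ (∀ i k, c (V i k) = k) ∧
      (∑ i, oddSign (homMatrix (V i)).det).natAbs = s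

lemma HasCover.mem_rdfSignatures {d s : ℕ} (h : HasCover d s) : s ∈ rdfSignatures (cube d) := by
  obtain ⟨ι, _, V, c, hV, hc, rfl⟩ := h
  exact hV.mem_rdfSignatures hc

section

variable {m n s : ℕ} {κ J : Type} [Fintype κ] [Fintype J] {W : κ → Fin (n + 1) → Fin n → Bool}
  {P : κ → J → Fin (m + n + 1) → Fin (m + 1) × Fin (n + 1)}

lemma HasCover.prod (h : HasCover m s) (hW : IsRegularCover W) (hP : IsLocalModel W P) :
    HasCover (m + n)
      (s * (∑ g, oddSign (homMatrix (W g)).det * ∑ j, (localMatrix (P g j)).det).natAbs) := by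
  obtain ⟨ι, _, V, c, hV, hc, rfl⟩ := h
  obtain ⟨c', hc'⟩ := hP.exists_colour_prodFamily hc
  refine ⟨_, inferInstance, _, c', hV.isRegularCover_prodFamily hc hW hP, hc', ?_⟩
  rw [hP.sum_oddSign_prodFamily, Int.natAbs_mul]

lemma finRotate_pow_zero (N k : ℕ) (hk : k < N + 1) :
    ((finRotate (N + 1)) ^ k) 0 = (⟨k, hk⟩ : Fin (N + 1)) := by
  induction k with
  | zero => simp
  | succ k ih =>
    rw [pow_succ', Equiv.Perm.mul_apply, ih (by omega), finRotate_of_lt (by omega)]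

/-- The staircase triangulations of the products of a simplex with the simplices `W g`, whose
vertices carry consecutive labels that start at `off g`. -/
def staircase (m n : ℕ) (off : κ → ℕ) (g : κ) (S : Shuffle m n) :
    Fin (m + n + 1) → Fin (m + 1) × Fin (n + 1) :=
  S.path ∘ (((finRotate (m + n + 1)) ^ off g)⁻¹ : Equiv.Perm (Fin (m + n + 1)))

omit [Fintype κ] in
lemma isLocalModel_staircase (m : ℕ) {off : κ → ℕ} {h : (Fin n → Bool) → ℕ}
    (hh : ∀ g q, h (W g q) = off g + q) : IsLocalModel W (staircase m n off) where
  exists_colour := by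
    -- The colour is `p` plus the label of `w`, modulo `m + n + 1`. Labels starting at `off g`
    -- rotate the path order by `off g`.
    refine ⟨fun p w => ((finRotate (m + n + 1)) ^ ((p : ℕ) + h w)) 0, fun g S t => ?_⟩
    set s := ((finRotate (m + n + 1)) ^ off g)⁻¹ t with hs
    have ht : ((finRotate (m + n + 1)) ^ off g) s = t := by rw [hs]; simp
    change ((finRotate (m + n + 1)) ^ (((S.path s).1 : ℕ) + h (W g (S.path s).2))) 0 = t
    rw [hh, add_left_comm, S.path_add, pow_add, Equiv.Perm.mul_apply,
      finRotate_pow_zero _ _ s.is_lt, ht]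
  exists_lift := by
    -- Shifting the labels by `off g` changes the lift by a function of `p` alone, which is absorbed
    -- into `α`.
    refine ⟨fun p w => -((p : ℕ) * (h w : ℕ)), fun g S => ?_⟩
    obtain ⟨α, β, hαβ⟩ := S.exists_slack_eq
    refine ⟨fun p => α p - (p : ℕ) * (off g : ℕ), fun q => β q, fun t => ?_, fun p q hpq => ?_⟩
    · have h1 := S.slack_path (((finRotate (m + n + 1)) ^ off g)⁻¹ t)
      rw [hαβ] at h1
      simp only [staircase, Function.comp_apply, hh]
      push_cast
      linarith
    · have h1 := S.slack_pos p q fun s hs =>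
        hpq (((finRotate (m + n + 1)) ^ off g) s) (by simp [staircase, hs])
      rw [hαβ] at h1
      simp only [hh]
      push_cast
      linarith
  injective := by
    intro g S S' hSS'
    apply Shuffle.path_injective
    exact (Equiv.surjective (((finRotate (m + n + 1)) ^ off g)⁻¹ :
      Equiv.Perm (Fin (m + n + 1)))).injective_comp_right hSS'
  surjective_left := by
    intro g S p
    obtain ⟨s, hs⟩ := countBelow_surjective S.left_strictMono p
    exact ⟨((finRotate (m + n + 1)) ^ off g) s, by simp [staircase, Shuffle.path, hs]⟩
  surjective_right := by
    intro g S q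
    obtain ⟨s, hs⟩ := countBelow_surjective S.right_strictMono q
    exact ⟨((finRotate (m + n + 1)) ^ off g) s, by simp [staircase, Shuffle.path, hs]⟩
  abs_det := by
    intro g S
    have : localMatrix (staircase m n off g S) =
        (localMatrix S.path).submatrix
        (((finRotate (m + n + 1)) ^ off g)⁻¹ : Equiv.Perm (Fin (m + n + 1))) id := rfl
    rw [this, Matrix.det_permute, Shuffle.det_localMatrix_path, abs_mul]
    simp
  card := by
    rw [Fintype.card_finset_len, Fintype.card_fin, ← mul_assoc, Nat.choose_symm_add,
      Nat.add_choose_mul_factorial_mul_factorial]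

omit [Fintype κ] in
lemma det_localMatrix_staircase (off : κ → ℕ) (g : κ) (S : Shuffle m n) :
    (localMatrix (staircase m n off g S)).det =
      ((-1) ^ (m + n)) ^ off g * (localMatrix S.path).det := by
  have : localMatrix (staircase m n off g S) =
      (localMatrix S.path).submatrix
        (((finRotate (m + n + 1)) ^ off g)⁻¹ : Equiv.Perm (Fin (m + n + 1))) id := rfl
  rw [this, Matrix.det_permute]
  simp

/-- The staircase product of a coloured triangulation and a labelled triangulation. -/
lemma HasCover.staircase_prod {k r ε : ℕ} (hcov : HasCover m s)
    {W : κ → Fin (2 * k + 1) → Fin (2 * k) → Bool} (hW : IsRegularCover W)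
    {off : κ → ℕ} {h : (Fin (2 * k) → Bool) → ℕ} (hh : ∀ g q, h (W g q) = off g + q)
    (hε : ε < 2) (hr : m + 2 * k = 2 * r + ε) :
    HasCover (m + 2 * k) (s *
      ((∑ g, oddSign (homMatrix (W g)).det * ((-1) ^ (m + 2 * k)) ^ off g).natAbs * r.choose k)) := by
  have := hcov.prod hW (isLocalModel_staircase m hh)
  simp only [det_localMatrix_staircase, ← Finset.mul_sum, ← mul_assoc, ← Finset.sum_mul] at this
  rwa [Int.natAbs_mul, Shuffle.natAbs_sum_det r k ε hε hr] at this

end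


/-! ### Explicit triangulations certified by integer computation. -/

/-- The determinant by expansion along first rows, in a form that can be evaluated. -/
def laplace : (n : ℕ) → (Fin n → Fin n → ℤ) → ℤ
  | 0, _ => 1
  | n + 1, A => ∑ j : Fin (n + 1), if A 0 j = 0 then 0 else
      (-1) ^ (j : ℕ) * A 0 j * laplace n fun i k => A i.succ (j.succAbove k)

lemma laplace_eq_det : ∀ {n : ℕ} (A : Matrix (Fin n) (Fin n) ℤ), laplace n A = A.det
  | 0, A => by simp [laplace]
  | n + 1, A => by
    rw [Matrix.det_succ_row_zero]
    simp only [laplace]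
    refine Finset.sum_congr rfl fun j _ => ?_
    split_ifs with h
    · simp [h]
    · congr 1
      exact laplace_eq_det (A.submatrix Fin.succ j.succAbove)

/-- The vertex of the cube whose coordinates are the binary digits of `x`. -/
def vertex (d x : ℕ) : Fin d → Bool := fun i => x.testBit i

/-- The number with given binary digits. -/
def code {d : ℕ} (v : Fin d → Bool) : ℕ := Nat.ofBits v

lemma code_lt {d : ℕ} (v : Fin d → Bool) : code v < 2 ^ d := Nat.ofBits_lt_two_pow v

@[simp] lemma vertex_code {d : ℕ} (v : Fin d → Bool) : vertex d (code v) = v := by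
  funext i
  simp [vertex, code, Nat.testBit_ofBits_lt]

lemma code_vertex {d x : ℕ} (hx : x < 2 ^ d) : code (vertex d x) = x := by
  refine Nat.eq_of_testBit_eq fun i => ?_
  rcases lt_or_ge i d with hi | hi
  · simp [vertex, code, Nat.testBit_ofBits_lt _ _ hi]
  · rw [code, Nat.testBit_ofBits_ge _ _ hi, Nat.testBit_lt_two_pow]
    exact hx.trans_le (Nat.pow_le_pow_right two_pos hi)

/-- The value at a vertex of the affine function with coefficients `u`. -/
def height {d : ℕ} (u : Fin (d + 1) → ℤ) (x : ℕ) : ℤ :=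
  u 0 + ∑ j : Fin d, if x.testBit j then u j.succ else 0

lemma affineOf_pt {d : ℕ} (u : Fin (d + 1) → ℤ) (x : ℕ) :
    affineOf (fun j => (u j : ℝ)) (pt (vertex d x)) = height u x := by
  rw [affineOf_apply, Fin.sum_univ_succ, height]
  push_cast
  congr 1
  · simp
  · refine Finset.sum_congr rfl fun j _ => ?_
    cases h : x.testBit j <;> simp [pt, vertex, h]

/-- The simplices whose vertices are listed by their codes. -/
def family {ι : Type} {d : ℕ} (F : ι → Fin (d + 1) → ℕ) : ι → Fin (d + 1) → Fin d → Bool :=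
  fun i k => vertex d (F i k)

theorem isRegularCover_family {ι : Type} [Fintype ι] {d : ℕ} {F : ι → Fin (d + 1) → ℕ} (L : ℕ → ℤ)
    (u : ι → Fin (d + 1) → ℤ) (D : ι → ℤ) (hlt : ∀ i k, F i k < 2 ^ d)
    (hon : ∀ i k, height (u i) (F i k) = L (F i k))
    (hoff : ∀ i, ∀ x < 2 ^ d, (∀ k, F i k ≠ x) → height (u i) x < L x)
    (hinj : ∀ i j, (∀ k, ∃ l, F j l = F i k) → i = j)
    (hdet : ∀ i, (homMatrix (family F i)).det = D i) (hD : ∀ i, D i ≠ 0)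
    (hsum : ∑ i, |D i| = d.factorial) : IsRegularCover (family F) where
  exists_lift := by
    refine ⟨fun v => L (code v), fun i => ⟨affineOf fun j => (u i j : ℝ), fun k => ?_,
      fun v hv => ?_⟩⟩
    · simp only [family, affineOf_pt, hon, code_vertex (hlt i k)]
    · conv_lhs => rw [← vertex_code v]
      rw [affineOf_pt]
      refine Int.cast_lt.2 (hoff i _ (code_lt v) fun k hk => hv k ?_)
      rw [family, hk, vertex_code]
  det_ne_zero := fun i => hdet i ▸ hD i
  injective := fun i j h => hinj i j fun k => by
    obtain ⟨l, hl⟩ : family F i k ∈ Set.range (family F j) := h ▸ Set.mem_range_self k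
    refine ⟨l, ?_⟩
    rw [← code_vertex (hlt j l), ← code_vertex (hlt i k)]
    exact congrArg code hl
  sum_det := by simpa only [hdet] using hsum

lemma code_family {ι : Type} {d : ℕ} {F : ι → Fin (d + 1) → ℕ} (hlt : ∀ i k, F i k < 2 ^ d) (i : ι)
    (k : Fin (d + 1)) : code (family F i k) = F i k :=
  code_vertex (hlt i k)

/-- A regular triangulation of the square. -/
def squareTable : Fin 2 → Fin 3 → ℕ := ![![0, 1, 2], ![1, 2, 3]]

/-- The determinants of the simplices in `squareTable`. -/
def squareDet : Fin 2 → ℤ := ![1, -1]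

lemma det_square (i : Fin 2) : (homMatrix (family squareTable i)).det = squareDet i := by
  rw [← laplace_eq_det]
  revert i
  decide +kernel

theorem isRegularCover_square : IsRegularCover (family squareTable) :=
  isRegularCover_family ([1, 0, 0, 1].getD · 0) ![![1, -1, -1], ![-1, 1, 1]] squareDet
    (by decide +kernel) (by decide +kernel) (by decide +kernel) (by decide +kernel) det_square
    (by decide +kernel) (by decide +kernel)

/-- A foldable triangulation of the `3`-cube, its vertices ordered by colour. -/
def cube3Table : Fin 5 → Fin 4 → ℕ :=
  ![![0, 1, 3, 5], ![0, 6, 3, 2], ![0, 6, 3, 5], ![0, 6, 4, 5], ![7, 6, 3, 5]]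

/-- The determinants of the simplices in `cube3Table`. -/
def cube3Det : Fin 5 → ℤ := ![1, 1, -2, 1, 1]

lemma det_cube3 (i : Fin 5) : (homMatrix (family cube3Table i)).det = cube3Det i := by
  rw [← laplace_eq_det]
  revert i
  decide +kernel

theorem isRegularCover_cube3 : IsRegularCover (family cube3Table) :=
  -- The lift is the parity of the digit sum: the even vertices span the central tetrahedron, of
  -- normalized volume 2, and each odd vertex is cut off as a unimodular corner.
  isRegularCover_family ([0, 1, 1, 0, 1, 0, 0, 1].getD · 0)
    ![![0, 1, -1, -1], ![0, -1, 1, -1], ![0, 0, 0, 0], ![0, -1, -1, 1], ![-2, 1, 1, 1]] cube3Det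
    (by decide +kernel) (by decide +kernel) (by decide +kernel) (by decide +kernel) det_cube3
    (by decide +kernel) (by decide +kernel)

/-- A foldable triangulation of the `4`-cube, its vertices ordered by colour. -/
def cube4Table : Fin 22 → Fin 5 → ℕ :=
  ![![0, 1, 3, 5, 13], ![0, 1, 3, 9, 13], ![0, 10, 3, 2, 6], ![0, 10, 3, 5, 6], ![0, 10, 3, 5, 13],
    ![0, 10, 3, 9, 13], ![0, 10, 4, 5, 6], ![0, 10, 4, 5, 13], ![0, 10, 4, 12, 13],
    ![0, 10, 8, 9, 13], ![0, 10, 8, 12, 13], ![14, 7, 3, 5, 6], ![14, 10, 3, 5, 6],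
    ![14, 7, 3, 5, 13], ![14, 10, 3, 5, 13], ![14, 7, 3, 15, 13], ![11, 10, 3, 9, 13],
    ![11, 10, 3, 15, 13], ![14, 10, 3, 15, 13], ![14, 10, 4, 5, 6], ![14, 10, 4, 5, 13],
    ![14, 10, 4, 12, 13]]

/-- The determinants of the simplices in `cube4Table`. -/
def cube4Det : Fin 22 → ℤ :=
  ![1, -1, -1, 2, -1, 2, -1, 1, -1, -1, 1, 1, -1, -1, 1, 1, -1, 1, -1, 1, -1, 1]

lemma det_cube4 (i : Fin 22) : (homMatrix (family cube4Table i)).det = cube4Det i := by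
  rw [← laplace_eq_det]
  revert i
  decide +kernel

theorem isRegularCover_cube4 : IsRegularCover (family cube4Table) :=
  isRegularCover_family ([6, 10, 10, 0, 10, 2, 10, 8, 10, 10, 0, 6, 12, 0, 6, 10].getD · 0)
    ![![6, 4, -10, -8, -2], ![6, 4, -10, -10, 0], ![6, -10, 4, 0, -10], ![6, -7, 1, 3, -7],
      ![6, -2, -4, -2, -2], ![6, 2, -8, -10, 2], ![6, -8, 0, 4, -6], ![6, -8, -4, 4, -2],
      ![6, -12, -8, 4, 2], ![6, 0, -10, -10, 4], ![6, -12, -10, 2, 4], ![-4, -2, 6, 8, -4],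
      ![0, -4, 4, 6, -4], ![-6, 0, 6, 8, -2], ![-2, -2, 4, 6, -2], ![-14, 4, 10, 8, 2],
      ![-2, 6, -4, -10, 6], ![-16, 6, 10, 4, 6], ![-14, 4, 10, 6, 4], ![4, -8, 0, 6, -4],
      ![4, -8, -2, 6, -2], ![4, -12, -6, 6, 2]] cube4Det
    (by decide +kernel) (by decide +kernel) (by decide +kernel) (by decide +kernel) det_cube4
    (by decide +kernel) (by decide +kernel)


/-- Triangulations of the products of a `4`-simplex with the two triangles of `squareTable`; the
pair of vertices `(p, q)` is listed as `3 * p + q`. -/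
def localTable : Fin 2 → Fin 15 → Fin 7 → ℕ :=
  ![
    ![![0, 1, 2, 5, 8, 11, 14], ![0, 1, 4, 5, 8, 11, 14], ![0, 1, 4, 7, 8, 11, 14],
      ![0, 1, 4, 7, 10, 11, 14], ![0, 1, 4, 7, 10, 13, 14], ![0, 3, 4, 5, 8, 11, 14],
      ![0, 3, 4, 7, 8, 11, 14], ![0, 3, 4, 7, 10, 11, 14], ![0, 3, 4, 7, 10, 13, 14],
      ![0, 3, 6, 7, 8, 11, 14], ![0, 3, 6, 7, 10, 11, 14], ![0, 3, 6, 7, 10, 13, 14],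
      ![0, 3, 6, 9, 10, 11, 14], ![0, 3, 6, 9, 10, 13, 14], ![0, 3, 6, 9, 12, 13, 14]],
    ![![2, 0, 1, 4, 7, 10, 13], ![2, 0, 3, 4, 7, 10, 13], ![2, 0, 3, 6, 7, 10, 13],
      ![2, 0, 3, 6, 9, 10, 13], ![2, 0, 3, 6, 9, 12, 13], ![2, 8, 3, 4, 5, 10, 13],
      ![2, 8, 3, 4, 7, 10, 13], ![2, 8, 3, 14, 5, 10, 11], ![2, 8, 3, 14, 5, 10, 13],
      ![2, 8, 3, 6, 7, 10, 13], ![2, 8, 3, 6, 9, 10, 13], ![2, 8, 3, 6, 9, 12, 13],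
      ![2, 8, 3, 14, 9, 10, 11], ![2, 8, 3, 14, 9, 10, 13], ![2, 8, 3, 14, 9, 12, 13]]]

/-- The pairs of vertices listed in `localTable`. -/
def localPairs (g : Fin 2) (j : Fin 15) (t : Fin (4 + 2 + 1)) : Fin (4 + 1) × Fin (2 + 1) :=
  (Fin.ofNat 5 (localTable g j t / 3), Fin.ofNat 3 (localTable g j t % 3))

/-- The colours of the points of the products triangulated by `localTable`. -/
def localColour (p : Fin 5) (x : ℕ) : Fin 7 :=
  (![![0, 1, 2, 0], ![1, 2, 3, 4], ![2, 3, 4, 1], ![3, 4, 5, 6], ![4, 5, 6, 3]] :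
    Fin 5 → Fin 4 → Fin 7) p (Fin.ofNat 4 x)

/-- A lifting function that induces the triangulations in `localTable`. -/
def localLift (p : Fin 5) (x : ℕ) : ℤ :=
  (![![-6, 0, 0, -5], ![0, 0, -4, 4], ![1, 0, -8, -3], ![2, 0, -12, 3], ![3, 0, -16, -2]] :
    Fin 5 → Fin 4 → ℤ) p (Fin.ofNat 4 x)

/-- The supporting affine functions of `localLift`, at the vertices of the `4`-simplex. -/
def localLeft : Fin 2 → Fin 15 → Fin 5 → ℤ :=
  ![
    ![![-6, -10, -14, -18, -22], ![-6, -6, -10, -14, -18], ![-6, -6, -6, -10, -14],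
      ![-6, -6, -6, -6, -10], ![-6, -6, -6, -6, -6], ![-6, 0, -4, -8, -12], ![-6, 0, 0, -4, -8],
      ![-6, 0, 0, 0, -4], ![-6, 0, 0, 0, 0], ![-6, 0, 1, -3, -7], ![-6, 0, 1, 1, -3],
      ![-6, 0, 1, 1, 1], ![-6, 0, 1, 2, -2], ![-6, 0, 1, 2, 2], ![-6, 0, 1, 2, 3]],
    ![![0, -4, -8, -12, -16], ![0, 0, -4, -8, -12], ![0, 0, 0, -4, -8], ![0, 0, 0, 0, -4],
      ![0, 0, 0, 0, 0], ![-9, 0, -7, -8, -12], ![-6, 0, -4, -8, -12], ![-9, 0, -7, -1, -6],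
      ![-9, 0, -7, -2, -6], ![-2, 0, 0, -4, -8], ![-2, 0, 0, 0, -4], ![-2, 0, 0, 0, 0],
      ![-8, 0, -6, 0, -5], ![-7, 0, -5, 0, -4], ![-3, 0, -1, 0, 0]]]

/-- The supporting affine functions of `localLift`, at the vertices of the triangles. -/
def localRight : Fin 2 → Fin 15 → Fin 3 → ℤ :=
  ![
    ![![0, 6, 6], ![0, 6, 2], ![0, 6, -2], ![0, 6, -6], ![0, 6, -10], ![0, 0, -4], ![0, 0, -8],
      ![0, 0, -12], ![0, 0, -16], ![0, -1, -9], ![0, -1, -13], ![0, -1, -17], ![0, -2, -14],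
      ![0, -2, -18], ![0, -3, -19]],
    ![![0, 0, -5], ![0, -4, -5], ![0, -8, -5], ![0, -12, -5], ![0, -16, -5], ![0, -4, 4],
      ![0, -4, 1], ![0, -11, 4], ![0, -10, 4], ![0, -8, -3], ![0, -12, -3], ![0, -16, -3],
      ![0, -12, 3], ![0, -12, 2], ![0, -16, -2]]]

/-- The determinants of the simplices in `localTable`. -/
def localDet : Fin 2 → Fin 15 → ℤ :=
  ![![1, -1, 1, -1, 1, 1, -1, 1, -1, 1, -1, 1, 1, -1, 1],
    ![1, -1, 1, -1, 1, -1, 1, -1, 1, -1, 1, -1, 1, -1, 1]]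

lemma det_localPairs (g : Fin 2) (j : Fin 15) :
    (localMatrix (localPairs g j)).det = localDet g j := by
  rw [← laplace_eq_det]
  revert g j
  decide +kernel

lemma squareTable_lt : ∀ i k, squareTable i k < 2 ^ 2 := by decide

theorem isLocalModel_localPairs : IsLocalModel (family squareTable) localPairs where
  exists_colour := by
    refine ⟨fun p v => localColour p (code v), ?_⟩
    simp only [code_family squareTable_lt]
    decide +kernel
  exists_lift := by
    refine ⟨fun p v => localLift p (code v), fun g j =>
      ⟨fun p => localLeft g j p, fun q => localRight g j q, fun t => ?_, fun p q h => ?_⟩⟩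
    · have : ∀ g j t, localLeft g j (localPairs g j t).1 + localRight g j (localPairs g j t).2 =
          localLift (localPairs g j t).1 (squareTable g (localPairs g j t).2) := by decide +kernel
      simp only [code_family squareTable_lt, ← this, Int.cast_add]
    · have : ∀ g j p q, (∀ t, localPairs g j t ≠ (p, q)) →
          localLeft g j p + localRight g j q < localLift p (squareTable g q) := by decide +kernel
      simp only [code_family squareTable_lt]
      exact_mod_cast this g j p q h
  injective := by
    have : ∀ g i j, (∀ t, localPairs g i t = localPairs g j t) → i = j := by decide +kernel
    exact fun g i j h => this g i j (congrFun h)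
  surjective_left := by decide +kernel
  surjective_right := by decide +kernel
  abs_det := by
    simp only [det_localPairs]
    decide +kernel
  card := by simp [Nat.factorial]

/-! ### Base cases and induction on the dimension. -/

lemma hasCover_three : HasCover 3 4 := by
  refine ⟨_, _, _, fun v => (![0, 1, 3, 2, 2, 3, 1, 0] : Fin 8 → Fin 4) (Fin.ofNat 8 (code v)),
    isRegularCover_cube3, ?_, ?_⟩
  · simp only [code_family (F := cube3Table) (by decide +kernel)]
    decide +kernel
  · simp only [det_cube3]
    decide +kernel

/-- The colouring of the vertices of `cube4Table`. -/
def cube4Colour (v : Fin 4 → Bool) : Fin 5 :=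
  (![0, 1, 3, 2, 2, 3, 4, 1, 2, 3, 1, 0, 3, 4, 0, 3] : Fin 16 → Fin 5) (Fin.ofNat 16 (code v))

lemma cube4Colour_family (i : Fin 22) (k : Fin 5) : cube4Colour (family cube4Table i k) = k := by
  rw [cube4Colour, code_family (by decide +kernel)]
  revert i k
  decide +kernel

lemma hasCover_four : HasCover 4 2 := by
  refine ⟨_, _, _, cube4Colour, isRegularCover_cube4, cube4Colour_family, ?_⟩
  simp only [det_cube4]
  decide +kernel

/-- Staircases would give 3 over each triangle of the square, and these cancel because the triangles
have opposite signs. `localTable` keeps the staircase over the first triangle but has signed count 1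
over the second, so the factor is `3 - 1 = 2`. -/
lemma hasCover_six : HasCover 6 4 := by
  have := hasCover_four.prod isRegularCover_square isLocalModel_localPairs
  simp only [det_localPairs, det_square] at this
  exact this

/-- The triangles carry labels `0, 1, 2` and `1, 2, 3`. The shift by one rotates an even number of
positions, an odd permutation, which compensates the opposite orientation: the triangles contribute
`1 + 1`, and the staircase `(r + 1).choose 1`. -/
lemma HasCover.add_two {r s : ℕ} (h : HasCover (2 * r + 1) s) :
    HasCover (2 * (r + 1) + 1) (s * (2 * (r + 1))) := by
  have := h.staircase_prod (k := 1) (r := r + 1) (ε := 1) isRegularCover_square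
    (off := fun g => (g : ℕ)) (h := code) (by
      intro g q
      rw [code_family squareTable_lt]
      revert g q
      decide +kernel) one_lt_two (by ring)
  have hodd : (-1 : ℤ) ^ (2 * r + 1 + 2 * 1) = -1 := Odd.neg_one_pow ⟨r + 1, by ring⟩
  simp only [hodd, det_square, Nat.choose_one_right] at this
  have h2 : (∑ g, oddSign (squareDet g) * (-1) ^ (g : ℕ)).natAbs = 2 := by decide +kernel
  rwa [h2] at this

/-- Here the labels are the colours of the 4-cube, so no shift occurs; the factor is its signature 2
times `(r + 2).choose 2`. -/
lemma HasCover.add_four {r s : ℕ} (h : HasCover (2 * r) s) :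
    HasCover (2 * (r + 2)) (s * ((r + 2) * (r + 1))) := by
  have := h.staircase_prod (k := 2) (r := r + 2) (ε := 0) isRegularCover_cube4
    (off := fun _ => 0) (h := fun v => cube4Colour v) (by
      intro g q
      rw [cube4Colour_family, zero_add]) two_pos (by ring)
  simp only [det_cube4, pow_zero, mul_one] at this
  have h2 : (∑ g, oddSign (cube4Det g)).natAbs = 2 := by decide +kernel
  have h3 : 2 * (r + 2).choose 2 = (r + 2) * (r + 1) := by
    have := Nat.add_one_mul_choose_eq (r + 1) 1
    rw [Nat.choose_one_right] at this
    rw [this, mul_comm]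
  rw [h2, h3] at this
  rwa [show 2 * (r + 2) = 2 * r + 2 * 2 by ring]

lemma hasCover_odd (r : ℕ) : HasCover (2 * (r + 1) + 1) (2 ^ (r + 2) * (r + 1).factorial) := by
  induction r with
  | zero => exact hasCover_three
  | succ r ih =>
    convert ih.add_two using 1
    rw [Nat.factorial_succ (r + 1)]
    ring

lemma hasCover_four_mul (r : ℕ) : HasCover (2 * (2 * r + 2)) (2 * r + 2).factorial := by
  induction r with
  | zero => exact hasCover_four
  | succ r ih =>
    have h : (2 * (r + 1) + 2).factorial =
        (2 * r + 2).factorial * ((2 * r + 2 + 2) * (2 * r + 2 + 1)) := by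
      rw [show 2 * (r + 1) + 2 = 2 * r + 2 + 1 + 1 by ring, Nat.factorial_succ, Nat.factorial_succ]
      ring
    rw [h]
    exact ih.add_four

/-- The ratio `2 / 3` comes from the base case, `4` against `3! = 6`, and persists because each step
multiplies both sides by the same factor. -/
lemma hasCover_four_mul_add_two (r : ℕ) :
    ∃ s, HasCover (2 * (2 * r + 3)) s ∧ 3 * s = 2 * (2 * r + 3).factorial := by
  induction r with
  | zero => exact ⟨4, hasCover_six, rfl⟩
  | succ r ih =>
    obtain ⟨s, hs, hs'⟩ := ih
    refine ⟨_, hs.add_four, ?_⟩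
    have h : (2 * (r + 1) + 3).factorial =
        (2 * r + 3 + 1 + 1) * ((2 * r + 3 + 1) * (2 * r + 3).factorial) := by
      rw [← Nat.factorial_succ, ← Nat.factorial_succ]
      rfl
    rw [h, ← mul_assoc, hs']
    ring

end CubeSignature

open CubeSignature in
theorem mainTheorem3 (d : ℕ) (hd : 3 ≤ d) :
    IsGreatest (CubeSignature.rdfSignatures (CubeSignature.cube d))
        (CubeSignature.signature (CubeSignature.cube d)) ∧
      (d % 2 = 1 →
        2 ^ ((d + 1) / 2) * ((d - 1) / 2).factorial ≤
          CubeSignature.signature (CubeSignature.cube d)) ∧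
      (d % 4 = 0 →
        (d / 2).factorial ≤ CubeSignature.signature (CubeSignature.cube d)) ∧
      (d % 4 = 2 →
        (2 / 3 : ℝ) * ((d / 2).factorial : ℝ) ≤
          (CubeSignature.signature (CubeSignature.cube d) : ℝ)) := by
  have hodd : d % 2 = 1 → HasCover d (2 ^ ((d + 1) / 2) * ((d - 1) / 2).factorial) := fun h => by
    obtain ⟨r, rfl⟩ : ∃ r, d = 2 * (r + 1) + 1 := ⟨d / 2 - 1, by omega⟩
    rw [show (2 * (r + 1) + 1 + 1) / 2 = r + 2 by omega,
      show (2 * (r + 1) + 1 - 1) / 2 = r + 1 by omega]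
    exact hasCover_odd r
  have h0 : d % 4 = 0 → HasCover d (d / 2).factorial := fun h => by
    obtain ⟨r, rfl⟩ : ∃ r, d = 2 * (2 * r + 2) := ⟨d / 4 - 1, by omega⟩
    rw [Nat.mul_div_cancel_left _ two_pos]
    exact hasCover_four_mul r
  have h2 : d % 4 = 2 → ∃ s, HasCover d s ∧ 3 * s = 2 * (d / 2).factorial := fun h => by
    obtain ⟨r, rfl⟩ : ∃ r, d = 2 * (2 * r + 3) := ⟨d / 4 - 1, by omega⟩
    rw [Nat.mul_div_cancel_left _ two_pos]
    exact hasCover_four_mul_add_two r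
  have key : ∀ s, HasCover d s → _ := fun s hs => isGreatest_signature hs.mem_rdfSignatures
  refine ⟨?_, fun h => (key _ (hodd h)).2, fun h => (key _ (h0 h)).2, fun h => ?_⟩
  · obtain h | h | h : d % 2 = 1 ∨ d % 4 = 0 ∨ d % 4 = 2 := by omega
    · exact (key _ (hodd h)).1
    · exact (key _ (h0 h)).1
    · obtain ⟨s, hs, -⟩ := h2 h
      exact (key _ hs).1
  · obtain ⟨s, hs, hs'⟩ := h2 h
    have h1 : (s : ℝ) ≤ signature (cube d) := Nat.cast_le.2 (key _ hs).2
    have h3 : (3 : ℝ) * s = 2 * (d / 2).factorial := by exact_mod_cast hs'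
    linarith
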